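/- Throughout, $R$ is a ring with unit and modules are left $R$-modules; $N\leq_\oplus M$ means that $N$ is a submodule of $M$ that is a direct summand of $M$. For a module $X$, $\mathrm{Add}(X)$ is the class of all modules isomorphic to a direct summand of a direct sum of copies of $X$. A module is $\mu$-generated (resp. ${<}\mu$-generated) if it has a set of generators of cardinality $\mu$ (resp. less than $\mu$). Let $\lambda<\kappa$ be infinite cardinals with $\lambda$ regular ($\kappa$ may be singular). Suppose that $(\star)_{\kappa,\lambda}$ holds: there is a stationary set $S\subseteq E^{\kappa^+}_\lambda=\{\alpha<\kappa^+ : \mathrm{cf}(\alpha)=\lambda\}$ which does not reflect (for no $\alpha<\kappa^+$ with $\mathrm{cf}(\alpha)>\omega$ is $S\cap\alpha$ stationary in $\alpha$), together with a tree-like ladder system $\langle c_\eta : \eta\in S\rangle$, that is, each $c_\eta:\lambda\to\eta$ is strictly increasing with range unbounded in $\eta$, and for all $\eta,\zeta\in S$ and $\delta,\delta'<\lambda$, if $c_\eta(\delta)=c_\zeta(\delta')$ then $\delta=\delta'$ and $c_\eta\restriction\delta=c_\zeta\restriction\delta$. Let $X$ be a ${<}\kappa$-generated module, and suppose that there is a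 $(\lambda,\mathrm{Add}(X))$-template $\langle N,L,\mathcal N\rangle$: $L\in\mathrm{Add}(X)$, $N$ is a submodule of $L$ which is not a direct summand of $L$, and $\mathcal N=\langle N_\alpha : \alpha<\lambda\rangle$ is an increasing sequence of submodules with $N_\alpha=\bigcup_{\beta<\alpha}N_\beta$ for each limit ordinal $\alpha<\lambda$, $N=\bigcup_{\alpha<\lambda}N_\alpha$, and $N_\alpha\leq_\oplus L$ for all $\alpha<\lambda$. Then there is a $\kappa^+$-generated module $M$ such that: 1. $M$ is $(\kappa^+,\mathrm{Add}(X))$-free: there is a set $\mathcal S$ of submodules of $M$, directed under inclusion, all of whose members belong to $\mathrm{Add}(X)$, which is closed under unions of nonempty well-ordered chains of length less than $\kappa^+$ and such that every subset of $M$ of cardinality less than $\kappa^+$ is contained in a member of $\mathcal S$; 2. $M$ is $(\kappa^+,\mathrm{Add}(X))$-separable: every subset of $M$ of cardinality less than $\kappa^+$ is contained in some $P\leq_\oplus M$ with $P\in\mathrm{Add}(X)$; 3. $M\notin\mathrm{Add}(X)$. -/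

import Mathlib

open Cardinal Ordinal Order

universe u v

/-! ### Stationary sets and ladder systems -/

/-- `S ∩ β` is a stationary subset of the ordinal `β`: it meets every subset of `β` that is closed
and unbounded in `β`. -/
def StationaryIn (S : Set Ordinal.{v}) (β : Ordinal.{v}) : Prop :=
  IsStationary (Subtype.val ⁻¹' S : Set (Set.Iio β))

/-- `S` does not reflect below `β`: there is no `α < β` of uncountable cofinality such that
`S ∩ α` is stationary in `α`. -/
def NonReflecting (S : Set Ordinal.{v}) (β : Ordinal.{v}) : Prop :=
  ∀ α < β, ℵ₀ < α.cof → ¬ StationaryIn S α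

/-- The set `E^μ_ν` of all ordinals below `μ` of cofinality `ν`. -/
def cofinalityClass (μ ν : Cardinal.{v}) : Set Ordinal.{v} :=
  {α | α < μ.ord ∧ α.cof = ν}

/-- `c` is a ladder system on `S`: for each `η ∈ S`, the function `c η`, restricted to `ν`, is
strictly increasing, has values below `η`, and its range is unbounded in `η`. -/
structure IsLadderSystem (ν : Cardinal.{v}) (S : Set Ordinal.{v})
    (c : Ordinal.{v} → Ordinal.{v} → Ordinal.{v}) : Prop where
  lt : ∀ η ∈ S, ∀ δ < ν.ord, c η δ < η
  strictMonoOn : ∀ η ∈ S, StrictMonoOn (c η) (Set.Iio ν.ord)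
  unbounded : ∀ η ∈ S, ∀ γ < η, ∃ δ < ν.ord, γ < c η δ

/-- A ladder system is tree-like if `c η δ = c ζ δ'` implies that `δ = δ'` and that `c η` and `c ζ`
agree below `δ`. -/
def IsTreeLike (ν : Cardinal.{v}) (S : Set Ordinal.{v})
    (c : Ordinal.{v} → Ordinal.{v} → Ordinal.{v}) : Prop :=
  ∀ η ∈ S, ∀ ζ ∈ S, ∀ δ < ν.ord, ∀ δ' < ν.ord, c η δ = c ζ δ' →
    δ = δ' ∧ ∀ ξ < δ, c η ξ = c ζ ξ

/-- The principle `(⋆)_{μ,ν}`: there is a non-reflecting stationary set of ordinals below `μ⁺` of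
cofinality `ν` that carries a tree-like ladder system. -/
def StarPrinciple (μ ν : Cardinal.{v}) : Prop :=
  ∃ S : Set Ordinal.{v},
    S ⊆ cofinalityClass (succ μ) ν ∧
    StationaryIn S (succ μ).ord ∧
    NonReflecting S (succ μ).ord ∧
    ∃ c : Ordinal.{v} → Ordinal.{v} → Ordinal.{v}, IsLadderSystem ν S c ∧ IsTreeLike ν S c

/-! ### Modules -/

/-- `M` has a set of generators of cardinality exactly `κ`. -/
def IsGeneratedBy (R : Type u) [Ring R] (κ : Cardinal.{v}) (M : Type v) [AddCommGroup M]
    [Module R M] : Prop :=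
  ∃ G : Set M, #G = κ ∧ Submodule.span R G = ⊤

/-- `M` has a set of generators of cardinality smaller than `κ`. -/
def IsLTGenerated (R : Type u) [Ring R] (κ : Cardinal.{v}) (M : Type v) [AddCommGroup M]
    [Module R M] : Prop :=
  ∃ G : Set M, #G < κ ∧ Submodule.span R G = ⊤

/-- A class of modules, given as a predicate. -/
abbrev ModuleClass (R : Type u) [Ring R] : Type (max u (v + 1)) :=
  ∀ (N : Type v) [AddCommGroup N] [Module R N], Prop

/-- `Add(X)`: the class of all modules isomorphic to a direct summand of a direct sum of copies
of `X`. -/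
def AddClass (R : Type u) [Ring R] (X : Type v) [AddCommGroup X] [Module R X] :
    ModuleClass.{u, v} R :=
  fun N _ _ => ∃ (ι : Type v) (P : Submodule R (ι →₀ X)), IsComplemented P ∧ Nonempty (N ≃ₗ[R] P)

/-- `(κ, 𝒳)`-dense systems of submodules of `M`. Nonempty unions of chains of submodules are
their suprema. -/
structure IsDenseSystem {R : Type u} [Ring R] (κ : Cardinal.{v}) (𝒳 : ModuleClass.{u, v} R)
    {M : Type v} [AddCommGroup M] [Module R M] (𝒮 : Set (Submodule R M)) : Prop where
  directedOn : DirectedOn (· ≤ ·) 𝒮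
  mem_class : ∀ P ∈ 𝒮, 𝒳 P
  iSup_mem : ∀ o : Ordinal.{v}, 0 < o → o < κ.ord → ∀ C : Set.Iio o → Submodule R M,
    Monotone C → (∀ i, C i ∈ 𝒮) → (⨆ i, C i) ∈ 𝒮
  exists_le : ∀ Y : Set M, #Y < κ → ∃ P ∈ 𝒮, Y ⊆ P

/-- `M` is `(κ, 𝒳)`-free. -/
def IsFreeRel {R : Type u} [Ring R] (κ : Cardinal.{v}) (𝒳 : ModuleClass.{u, v} R)
    (M : Type v) [AddCommGroup M] [Module R M] : Prop :=
  ∃ 𝒮 : Set (Submodule R M), IsDenseSystem κ 𝒳 𝒮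

/-- `M` is `(κ, 𝒳)`-separable: every subset of `M` of cardinality smaller than `κ` is contained in
a direct summand of `M` that belongs to `𝒳`. -/
def IsSeparableRel {R : Type u} [Ring R] (κ : Cardinal.{v}) (𝒳 : ModuleClass.{u, v} R)
    (M : Type v) [AddCommGroup M] [Module R M] : Prop :=
  ∀ Y : Set M, #Y < κ → ∃ P : Submodule R M, IsComplemented P ∧ 𝒳 P ∧ Y ⊆ P

/-- `⟨N, L, F⟩` is a `(ν, 𝒳)`-template: `L` belongs to `𝒳`, the sequence `F`, indexed by the
ordinals below `ν`, is a continuous increasing sequence of submodules with union `N`, each term of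
which is a direct summand of `L`, but `N` is not a direct summand of `L`. -/
structure IsTemplate {R : Type u} [Ring R] (ν : Cardinal.{v}) (𝒳 : ModuleClass.{u, v} R)
    (L : Type v) [AddCommGroup L] [Module R L] (N : Submodule R L)
    (F : Ordinal.{v} → Submodule R L) : Prop where
  mem_class : 𝒳 L
  monotoneOn : MonotoneOn F (Set.Iio ν.ord)
  continuous : ∀ α < ν.ord, IsSuccLimit α → (F α : Set L) = ⋃ β : Set.Iio α, (F β : Set L)
  union : (N : Set L) = ⋃ β : Set.Iio ν.ord, (F β : Set L)
  isComplemented : ∀ α < ν.ord, IsComplemented (F α)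
  not_isComplemented : ¬ IsComplemented N

/-! ### Retracts and `Add(X)` -/

section Add

variable {R : Type u} [Ring R] {X : Type v} [AddCommGroup X] [Module R X]

/-! Take a copy L_η of the template module for each η ∈ S and glue L_η to L_ζ along F (δ + 1)
whenever c_η(δ) = c_ζ(δ). The result M is filtered by the stages M_α, spanned by the copies with η <
α. Two ladders agree on an initial segment, by tree-likeness, so projections of different copies can
be chosen compatibly. A copy whose ladder meets the preceding ones in a bounded set meets their sum
in a summand (`isComplemented_partialSup`).

If α ∉ S, every ladder of index above α leaves α after boundedly many rungs, so M_α is a summand of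
M (`Glued.isComplemented_sub`). Every M_α with α < κ⁺ lies in Add(X): non-reflection yields a
well-ordering of the ladders below α in which each meets the union of its predecessors in a bounded
set (`exists_rank`), and M_α becomes a direct sum of summands of copies of L
(`Glued.exists_retract_sub`). Freeness and separability follow.

If M were in Add(X), a closure argument and stationarity would give η ∈ S such that M_η is a summand
and every rung of c_η lies on an earlier ladder. Then L_η meets M_η exactly in the union of the
filtration, and a retraction of M onto L_η would make that union a summand of L. The closure
argument needs L to have at most κ generators, so the template is first cut down to a small layer of
a direct sum (`IsTemplate.exists_small`). -/

theorem Submodule.isComplemented_of_retraction {M : Type*} [AddCommGroup M] [Module R M]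
    {P : Submodule R M} (p : M →ₗ[R] M) (hp : ∀ x, p x ∈ P) (hp' : ∀ x ∈ P, p x = x) :
    IsComplemented P :=
  ⟨_, LinearMap.isCompl_of_proj (f := p.codRestrict P hp) fun x => Subtype.ext (hp' x x.2)⟩

theorem Submodule.exists_retraction {M : Type*} [AddCommGroup M] [Module R M]
    {P : Submodule R M} (h : IsComplemented P) :
    ∃ p : M →ₗ[R] M, (∀ x, p x ∈ P) ∧ ∀ x ∈ P, p x = x := by
  obtain ⟨Q, hQ⟩ := h
  exact ⟨P.projection Q hQ, Submodule.projection_apply_mem hQ,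
    fun x hx => Submodule.projection_apply_of_mem_left hQ hx⟩

theorem AddClass.of_retract {N : Type v} [AddCommGroup N] [Module R N] {ι : Type v}
    (f : N →ₗ[R] (ι →₀ X)) (g : (ι →₀ X) →ₗ[R] N) (h : ∀ x, g (f x) = x) : AddClass R X N := by
  refine ⟨ι, LinearMap.range f, Submodule.isComplemented_of_retraction (f ∘ₗ g) ?_ ?_,
    ⟨LinearEquiv.ofInjective f (Function.LeftInverse.injective h)⟩⟩
  · intro x
    exact ⟨g x, rfl⟩
  · rintro _ ⟨x, rfl⟩
    simp [h]

theorem AddClass.exists_retract {N : Type v} [AddCommGroup N] [Module R N]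
    (h : AddClass R X N) : ∃ (ι : Type v) (f : N →ₗ[R] (ι →₀ X)) (g : (ι →₀ X) →ₗ[R] N),
      ∀ x, g (f x) = x := by
  obtain ⟨ι, P, hP, ⟨e⟩⟩ := h
  obtain ⟨p, hp, hp'⟩ := Submodule.exists_retraction hP
  refine ⟨ι, P.subtype ∘ₗ e.toLinearMap, e.symm.toLinearMap ∘ₗ p.codRestrict P hp, fun x => ?_⟩
  have : p.codRestrict P hp (e x) = e x := Subtype.ext (hp' _ (e x).2)
  simp [this]

end Add

/-! ### Gluing copies of a module along a filtration -/

section Gluing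

variable {R : Type u} [Ring R] {L : Type v} [AddCommGroup L] [Module R L] {I : Type v}

/-- The sum of the successor terms of the sequence `F` with indices in `T`. -/
def partialSup (F : Ordinal.{v} → Submodule R L) (T : Set Ordinal.{v}) : Submodule R L :=
  ⨆ δ ∈ T, F (δ + 1)

theorem le_partialSup (F : Ordinal.{v} → Submodule R L) {T : Set Ordinal.{v}} {δ : Ordinal.{v}}
    (h : δ ∈ T) : F (δ + 1) ≤ partialSup F T :=
  le_iSup₂_of_le δ h le_rfl

theorem partialSup_le {F : Ordinal.{v} → Submodule R L} {T : Set Ordinal.{v}} {P : Submodule R L}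
    (h : ∀ δ ∈ T, F (δ + 1) ≤ P) : partialSup F T ≤ P :=
  iSup₂_le h

theorem partialSup_mono (F : Ordinal.{v} → Submodule R L) {T T' : Set Ordinal.{v}} (h : T ⊆ T') :
    partialSup F T ≤ partialSup F T' :=
  partialSup_le fun _ hδ => le_partialSup F (h hδ)

/-- The relations that identify the copies with indices `i` and `j` along `F (δ + 1)` if the
functions `c i` and `c j` agree at `δ < o`. -/
noncomputable def gluingRelations (F : Ordinal.{v} → Submodule R L) (o : Ordinal.{v})
    (c : I → Ordinal.{v} → Ordinal.{v}) : Submodule R (I →₀ L) :=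
  Submodule.span R {z | ∃ i j δ x, δ < o ∧ c i δ = c j δ ∧ x ∈ F (δ + 1) ∧
    z = Finsupp.single i x - Finsupp.single j x}

/-- The module obtained from `I`-many copies of `L` by gluing along the filtration `F`. -/
noncomputable abbrev Glued (F : Ordinal.{v} → Submodule R L) (o : Ordinal.{v})
    (c : I → Ordinal.{v} → Ordinal.{v}) : Type v :=
  (I →₀ L) ⧸ gluingRelations F o c

/-- The indices at which `c i` agrees with `c j` for some `j ∈ A`. -/
def agreeSet (o : Ordinal.{v}) (c : I → Ordinal.{v} → Ordinal.{v}) (A : Set I) (i : I) :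
    Set Ordinal.{v} :=
  {δ | δ < o ∧ ∃ j ∈ A, c i δ = c j δ}

namespace Glued

variable (F : Ordinal.{v} → Submodule R L) (o : Ordinal.{v}) (c : I → Ordinal.{v} → Ordinal.{v})

/-- The map from the copy of `L` with index `i`. -/
noncomputable def of (i : I) : L →ₗ[R] Glued F o c :=
  (gluingRelations F o c).mkQ ∘ₗ Finsupp.lsingle i

variable {F o c}

theorem of_eq {i j : I} {δ : Ordinal.{v}} (hδ : δ < o) (h : c i δ = c j δ) {x : L}
    (hx : x ∈ F (δ + 1)) : of F o c i x = of F o c j x := by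
  refine (Submodule.Quotient.eq _).2 (Submodule.subset_span ⟨i, j, δ, x, hδ, h, hx, rfl⟩)

theorem iSup_range_of : ⨆ i, LinearMap.range (of F o c i) = ⊤ := by
  have h : ⨆ i, LinearMap.range (Finsupp.lsingle i : L →ₗ[R] I →₀ L) = ⊤ :=
    Finsupp.iSup_lsingle_range
  have h2 := congrArg (Submodule.map (gluingRelations F o c).mkQ) h
  rw [Submodule.map_iSup, Submodule.map_top, Submodule.range_mkQ] at h2
  rw [← h2]
  exact iSup_congr fun i => LinearMap.range_comp _ _

/-- The universal property of the glued module. -/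
theorem exists_lift {Q : Type*} [AddCommGroup Q] [Module R Q] (f : I → L →ₗ[R] Q)
    (hf : ∀ i j δ x, δ < o → c i δ = c j δ → x ∈ F (δ + 1) → f i x = f j x) :
    ∃ g : Glued F o c →ₗ[R] Q, ∀ i x, g (of F o c i x) = f i x := by
  refine ⟨(gluingRelations F o c).liftQ (Finsupp.lsum ℕ f) ?_, fun i x => ?_⟩
  · refine Submodule.span_le.2 ?_
    rintro _ ⟨i, j, δ, x, hδ, h, hx, rfl⟩
    rw [SetLike.mem_coe, LinearMap.mem_ker, map_sub]
    simp [hf i j δ x hδ h hx]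
  · refine (Submodule.liftQ_apply _ _ _).trans ?_
    simp

variable (F o c) in
/-- The submodule generated by the copies of `L` with indices in `A`. -/
noncomputable def sub (A : Set I) : Submodule R (Glued F o c) :=
  ⨆ i ∈ A, LinearMap.range (of F o c i)

theorem of_mem_sub {A : Set I} {i : I} (hi : i ∈ A) (x : L) : of F o c i x ∈ sub F o c A :=
  le_iSup₂_of_le (f := fun i _ => LinearMap.range (of F o c i)) i hi le_rfl ⟨x, rfl⟩

theorem sub_le {A : Set I} {P : Submodule R (Glued F o c)}
    (h : ∀ i ∈ A, ∀ x, of F o c i x ∈ P) : sub F o c A ≤ P := by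
  refine iSup₂_le fun i hi => ?_
  rintro _ ⟨x, rfl⟩
  exact h i hi x

theorem sub_mono {A B : Set I} (h : A ⊆ B) : sub F o c A ≤ sub F o c B :=
  sub_le fun _ hi x => of_mem_sub (h hi) x

/-- The part of copy i that the relations identify directly with copies in A. -/
theorem of_mem_sub_of_mem_partialSup {A : Set I} {i : I} {x : L}
    (hx : x ∈ partialSup F (agreeSet o c A i)) : of F o c i x ∈ sub F o c A := by
  have : partialSup F (agreeSet o c A i) ≤ (sub F o c A).comap (of F o c i) := by
    refine partialSup_le ?_
    rintro δ ⟨hδ, j, hj, h⟩ y hy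
    rw [Submodule.mem_comap, of_eq hδ h hy]
    exact of_mem_sub hj y
  exact this hx

/-- A compatible family of endomorphisms of the copies of `L`: the identity for the indices in `A`
and projections onto the intersections with `sub F o c A` for the other indices. -/
theorem exists_slice (hmono : ∀ α β, α ≤ β → β < o → F α ≤ F β) (ho : ∀ δ < o, δ + 1 < o)
    (htree : ∀ i j δ, δ < o → c i δ = c j δ → ∀ ξ < δ, c i ξ = c j ξ) (A : Set I)
    (hA : ∀ i ∉ A, IsComplemented (partialSup F (agreeSet o c A i))) :
    ∃ f : I → L →ₗ[R] L, (∀ i ∈ A, f i = LinearMap.id) ∧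
      (∀ i ∉ A, ∀ x, f i x ∈ partialSup F (agreeSet o c A i)) ∧
      (∀ i, ∀ x ∈ partialSup F (agreeSet o c A i), f i x = x) ∧
      ∀ i j δ x, δ < o → c i δ = c j δ → x ∈ F (δ + 1) →
        f i x = f j x ∧ of F o c i (f i x) = of F o c j (f j x) := by
  classical
  -- The projection is chosen as a function of the set T, so copies with equal agreement sets
  -- receive the same one.
  have key : ∀ T : Set Ordinal.{v}, ∃ p : L →ₗ[R] L, IsComplemented (partialSup F T) →
      (∀ x, p x ∈ partialSup F T) ∧ ∀ x ∈ partialSup F T, p x = x := by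
    intro T
    by_cases h : IsComplemented (partialSup F T)
    · obtain ⟨p, hp⟩ := Submodule.exists_retraction h
      exact ⟨p, fun _ => hp⟩
    · exact ⟨0, fun h' => (h h').elim⟩
  choose p hp using key
  have hid : ∀ i, ∀ x ∈ partialSup F (agreeSet o c A i),
      (if i ∈ A then LinearMap.id else p (agreeSet o c A i)) x = x := by
    intro i x hx
    by_cases hi : i ∈ A
    · simp [hi]
    · simpa [hi] using (hp _ (hA i hi)).2 x hx
  refine ⟨fun i => if i ∈ A then LinearMap.id else p (agreeSet o c A i), fun i hi => if_pos hi,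
    fun i hi x => ?_, hid, ?_⟩
  · simpa [hi] using (hp _ (hA i hi)).1 x
  intro i j δ x hδ h hx
  by_cases hmem : δ ∈ agreeSet o c A i
  · have hmem' : δ ∈ agreeSet o c A j := by
      obtain ⟨_, k, hk, hk'⟩ := hmem
      exact ⟨hδ, k, hk, h ▸ hk'⟩
    simp only [hid i x (le_partialSup F hmem hx), hid j x (le_partialSup F hmem' hx), true_and]
    exact of_eq hδ h hx
  -- Here δ lies outside the agreement set of i. Tree-likeness then makes the two sets equal and
  -- contained in δ, so both copies use the same projection, with image inside F (δ + 1).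
  · have hi : i ∉ A := fun hi => hmem ⟨hδ, i, hi, rfl⟩
    have hj : j ∉ A := fun hj => hmem ⟨hδ, j, hj, h⟩
    have below : ∀ ξ ∈ agreeSet o c A i, ξ < δ := by
      rintro ξ ⟨hξ, k, hk, hk'⟩
      by_contra! hle
      rcases hle.eq_or_lt with rfl | hlt
      · exact hmem ⟨hδ, k, hk, hk'⟩
      · exact hmem ⟨hδ, k, hk, htree i k ξ hξ hk' δ hlt⟩
    have heq : agreeSet o c A i = agreeSet o c A j := by
      ext ξ
      constructor
      · intro hmem'
        obtain ⟨hξ, k, hk, hk'⟩ := hmem'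
        exact ⟨hξ, k, hk, htree i j δ hδ h ξ (below ξ ⟨hξ, k, hk, hk'⟩) ▸ hk'⟩
      · rintro ⟨hξ, k, hk, hk'⟩
        refine ⟨hξ, k, hk, ?_⟩
        rcases lt_or_ge ξ δ with hlt | hle
        · rw [htree i j δ hδ h ξ hlt, hk']
        · exfalso
          rcases hle.eq_or_lt with rfl | hlt
          · exact hmem ⟨hδ, k, hk, h.trans hk'⟩
          · exact hmem ⟨hδ, k, hk, h.trans (htree j k ξ hξ hk' δ hlt)⟩
    simp only [hi, hj, if_false, ← heq, true_and]
    refine of_eq hδ h (partialSup_le (fun ξ hξ => ?_) ((hp _ (hA i hi)).1 x))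
    exact hmono _ _ (by gcongr; exact (below ξ hξ).le) (ho δ hδ)

/-- The slice maps glue to a retraction: they fix the copies in A and send every other copy into the
part already identified with A. -/
theorem isComplemented_sub (hmono : ∀ α β, α ≤ β → β < o → F α ≤ F β) (ho : ∀ δ < o, δ + 1 < o)
    (htree : ∀ i j δ, δ < o → c i δ = c j δ → ∀ ξ < δ, c i ξ = c j ξ) (A : Set I)
    (hA : ∀ i ∉ A, IsComplemented (partialSup F (agreeSet o c A i))) :
    IsComplemented (sub F o c A) := by
  obtain ⟨f, hf1, hf2, -, hf4⟩ := exists_slice hmono ho htree A hA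
  obtain ⟨p, hp⟩ := exists_lift (F := F) (o := o) (c := c) (fun i => of F o c i ∘ₗ f i)
    fun i j δ x hδ h hx => (hf4 i j δ x hδ h hx).2
  refine Submodule.isComplemented_of_retraction p (fun x => ?_) fun x hx => ?_
  · have : ⨆ i, LinearMap.range (of F o c i) ≤ (sub F o c A).comap p := by
      refine iSup_le fun i => ?_
      rintro _ ⟨y, rfl⟩
      rw [Submodule.mem_comap, hp]
      by_cases hi : i ∈ A
      · exact of_mem_sub hi _
      · exact of_mem_sub_of_mem_partialSup (hf2 i hi y)
    rw [iSup_range_of] at this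
    exact this trivial
  · have : sub F o c A ≤ LinearMap.eqLocus p LinearMap.id := by
      refine sub_le fun i hi y => ?_
      simp [LinearMap.mem_eqLocus, hp, hf1 i hi]
    exact this hx

/-- Retractions of the glued module onto the copies of `L`. -/
theorem exists_toPiece (hmono : ∀ α β, α ≤ β → β < o → F α ≤ F β) (ho : ∀ δ < o, δ + 1 < o)
    (htree : ∀ i j δ, δ < o → c i δ = c j δ → ∀ ξ < δ, c i ξ = c j ξ) (i : I)
    (hA : ∀ j, j ≠ i → IsComplemented (partialSup F (agreeSet o c {i} j))) :
    ∃ r : Glued F o c →ₗ[R] L, (∀ x, r (of F o c i x) = x) ∧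
      ∀ j, j ≠ i → ∀ x, r (of F o c j x) ∈ partialSup F (agreeSet o c {i} j) := by
  obtain ⟨f, hf1, hf2, -, hf4⟩ := exists_slice hmono ho htree {i} hA
  obtain ⟨r, hr⟩ := exists_lift (F := F) (o := o) (c := c) f
    fun i j δ x hδ h hx => (hf4 i j δ x hδ h hx).1
  refine ⟨r, fun x => ?_, fun j hj x => ?_⟩
  · rw [hr, hf1 i rfl, LinearMap.id_apply]
  · rw [hr]
    exact hf2 j hj x

/-- Taken in the order of ρ, each copy contributes a complement of the part covered by its
predecessors, and the whole is the direct sum of these complements. -/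
theorem exists_retract_sub (hmono : ∀ α β, α ≤ β → β < o → F α ≤ F β) (ho : ∀ δ < o, δ + 1 < o)
    (htree : ∀ i j δ, δ < o → c i δ = c j δ → ∀ ξ < δ, c i ξ = c j ξ)
    (hpair : ∀ i j, j ≠ i → IsComplemented (partialSup F (agreeSet o c {i} j)))
    (A : Set I) (ρ : I → Ordinal.{v}) (hρ : Set.InjOn ρ A)
    (hA : ∀ i ∈ A, IsComplemented (partialSup F (agreeSet o c {j | j ∈ A ∧ ρ j < ρ i} i))) :
    ∃ (f : sub F o c A →ₗ[R] (I →₀ L)) (g : (I →₀ L) →ₗ[R] sub F o c A), ∀ x, g (f x) = x := by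
  classical
  have hq : ∀ i, ∃ q : L →ₗ[R] L, (i ∉ A → q = 0) ∧ (∀ x, q (q x) = q x) ∧
      (i ∈ A → (∀ x, x - q x ∈ partialSup F (agreeSet o c {j | j ∈ A ∧ ρ j < ρ i} i)) ∧
        ∀ x ∈ partialSup F (agreeSet o c {j | j ∈ A ∧ ρ j < ρ i} i), q x = 0) := by
    intro i
    by_cases hi : i ∈ A
    · obtain ⟨p, hp, hp'⟩ := Submodule.exists_retraction (hA i hi)
      refine ⟨LinearMap.id - p, fun h => (h hi).elim, fun x => ?_,
        fun _ => ⟨fun x => ?_, fun x hx => ?_⟩⟩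
      · simp [hp' _ (hp x)]
      · simpa using hp x
      · simp [hp' x hx]
    · exact ⟨0, fun _ => rfl, by simp, fun h => (hi h).elim⟩
  choose q hq0 hqq hq1 using hq
  -- `E` projects each coordinate to its chosen complement, and `g₀` will be an isomorphism from the
  -- range of `E` onto `sub F o c A`.
  let E : (I →₀ L) →ₗ[R] (I →₀ L) := Finsupp.lsum ℕ fun i => Finsupp.lsingle i ∘ₗ q i
  have hE : ∀ z i, E z i = q i (z i) := by
    intro z i
    induction z using Finsupp.induction_linear with
    | zero => simp
    | add a b ha hb => simp [ha, hb]
    | single j x =>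
      by_cases h : j = i
      · subst h; simp [E]
      · simp [E, Finsupp.single_eq_of_ne' h]
  let g₀ : (I →₀ L) →ₗ[R] Glued F o c := Finsupp.lsum ℕ fun i => of F o c i ∘ₗ q i
  have hg₀ : ∀ i x, g₀ (Finsupp.single i x) = of F o c i (q i x) := by
    intro i x
    simp [g₀]
  have hgE : ∀ z, g₀ (E z) = g₀ z := by
    intro z
    induction z using Finsupp.induction_linear with
    | zero => simp
    | add a b ha hb => simp only [map_add, ha, hb]
    | single j x => simp [E, hg₀, hqq]
  have hmem : ∀ z, g₀ z ∈ sub F o c A := by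
    intro z
    induction z using Finsupp.induction_linear with
    | zero => simp
    | add a b ha hb => rw [map_add]; exact add_mem ha hb
    | single j x =>
      rw [hg₀]
      by_cases hj : j ∈ A
      · exact of_mem_sub hj _
      · simp [hq0 j hj]
  have hsurj : sub F o c A ≤ LinearMap.range g₀ := by
    have : ∀ a : Ordinal.{v}, ∀ i ∈ A, ρ i = a → ∀ x, of F o c i x ∈ LinearMap.range g₀ := by
      intro a
      induction a using WellFoundedLT.induction with
      | ind a ih =>
        rintro i hi rfl x
        have h1 : of F o c i (q i x) ∈ LinearMap.range g₀ := ⟨Finsupp.single i x, hg₀ i x⟩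
        have h2 : of F o c i (x - q i x) ∈ LinearMap.range g₀ := by
          have h3 : sub F o c {j | j ∈ A ∧ ρ j < ρ i} ≤ LinearMap.range g₀ :=
            sub_le fun j hj y => ih _ hj.2 j hj.1 rfl y
          exact h3 (of_mem_sub_of_mem_partialSup ((hq1 i hi).1 x))
        simpa using add_mem h1 h2
    exact sub_le fun i hi x => this _ i hi rfl x
  have hinj : ∀ z, E z = z → g₀ z = 0 → z = 0 := by
    intro z hz h0
    by_contra hne
    have hsupp : ∀ i, z i ≠ 0 → i ∈ A := by
      intro i hi
      by_contra hiA
      rw [← hz, hE, hq0 i hiA] at hi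
      exact hi rfl
    -- Retracting onto the copy of highest rank in the support sends all other terms into the part P
    -- killed by `q i`. So z i ∈ P, and z i = q i (z i) = 0.
    obtain ⟨i, hi, hmax⟩ := z.support.exists_max_image ρ (Finsupp.support_nonempty_iff.2 hne)
    have hi' : z i ≠ 0 := Finsupp.mem_support_iff.1 hi
    have hiA := hsupp i hi'
    obtain ⟨r, hr1, hr2⟩ := exists_toPiece (F := F) (o := o) (c := c) hmono ho htree i (hpair i)
    set P := partialSup F (agreeSet o c {j | j ∈ A ∧ ρ j < ρ i} i)
    have hsum : g₀ z = ∑ j ∈ z.support, of F o c j (z j) := by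
      conv_lhs => rw [← Finsupp.sum_single z]
      rw [Finsupp.sum, map_sum]
      refine Finset.sum_congr rfl fun j _ => ?_
      rw [hg₀, ← hE, hz]
    rw [hsum, ← Finset.add_sum_erase _ _ hi] at h0
    have h1 := congrArg r h0
    rw [map_add, hr1, map_sum, map_zero] at h1
    have h2 : ∑ j ∈ z.support.erase i, r (of F o c j (z j)) ∈ P := by
      refine Submodule.sum_mem _ fun j hj => ?_
      obtain ⟨hji, hjz⟩ := Finset.mem_erase.1 hj
      have hjA := hsupp j (Finsupp.mem_support_iff.1 hjz)
      refine partialSup_mono F ?_ (hr2 j hji (z j))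
      rintro δ ⟨hδ, k, rfl, hk⟩
      exact ⟨hδ, j, ⟨hjA, lt_of_le_of_ne (hmax j hjz) fun h => hji (hρ hjA hiA h)⟩, hk.symm⟩
    have h3 : z i ∈ P := by
      rw [eq_neg_of_add_eq_zero_left h1]
      exact neg_mem h2
    apply hi'
    rw [← hz, hE]
    exact (hq1 i hiA).2 _ h3
  let D : Submodule R (I →₀ L) := LinearMap.range E
  have hD : ∀ z ∈ D, E z = z := by
    rintro _ ⟨z, rfl⟩
    ext i
    rw [hE, hE, hqq]
  let g : (I →₀ L) →ₗ[R] sub F o c A := g₀.codRestrict _ hmem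
  let e : D ≃ₗ[R] sub F o c A := LinearEquiv.ofBijective (g ∘ₗ D.subtype) <| by
    constructor
    · rw [injective_iff_map_eq_zero]
      rintro ⟨z, hz⟩ h
      exact Subtype.ext (hinj z (hD z hz) (congrArg Subtype.val h))
    · rintro ⟨y, hy⟩
      obtain ⟨z, rfl⟩ := hsurj hy
      exact ⟨⟨E z, z, rfl⟩, Subtype.ext (hgE z)⟩
  exact ⟨D.subtype ∘ₗ e.symm.toLinearMap, g, fun x => e.apply_symm_apply x⟩

end Glued

end Gluing

/-! ### Ladder systems on non-reflecting sets -/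

section Ladders

variable {κ lam : Cardinal.{v}} {S : Set Ordinal.{v}} {c : Ordinal.{v} → Ordinal.{v} → Ordinal.{v}}

theorem isSuccLimit_of_mem_cofinalityClass (hlam : ℵ₀ ≤ lam) {μ : Cardinal.{v}} {ζ : Ordinal.{v}}
    (h : ζ ∈ cofinalityClass μ lam) : IsSuccLimit ζ := by
  rw [← Ordinal.one_lt_cof_iff, h.2]
  exact one_lt_aleph0.trans_le hlam

theorem IsLadderSystem.exists_agree_lt_of_lt (hc : IsLadderSystem lam S c) {ζ ξ : Ordinal.{v}}
    (hζ : ζ ∈ S) (hξ : ξ ∈ S) (h : ζ < ξ) :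
    ∃ γ < lam.ord, ∀ δ < lam.ord, c ξ δ = c ζ δ → δ < γ := by
  obtain ⟨γ, hγ, hlt⟩ := hc.unbounded ξ hξ ζ h
  refine ⟨γ, hγ, fun δ hδ heq => ?_⟩
  by_contra! hle
  have h1 := (hc.strictMonoOn ξ hξ).monotoneOn hγ hδ hle
  rw [heq] at h1
  exact (hlt.trans_le h1).not_gt (hc.lt ζ hζ δ hδ)

theorem IsLadderSystem.exists_agree_lt (hc : IsLadderSystem lam S c) {ζ ξ : Ordinal.{v}}
    (hζ : ζ ∈ S) (hξ : ξ ∈ S) (h : ζ ≠ ξ) :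
    ∃ γ < lam.ord, ∀ δ < lam.ord, c ξ δ = c ζ δ → δ < γ := by
  rcases h.lt_or_gt with h | h
  · exact hc.exists_agree_lt_of_lt hζ hξ h
  · obtain ⟨γ, hγ, h'⟩ := hc.exists_agree_lt_of_lt hξ hζ h
    exact ⟨γ, hγ, fun δ hδ heq => h' δ hδ heq.symm⟩

/-- Below a limit ordinal there is a cofinal set that does not accumulate at points of a
non-reflecting set. -/
theorem exists_cofinal_not_accumulating (hlam : ℵ₀ ≤ lam) (hS : S ⊆ cofinalityClass (succ κ) lam)
    (hnr : NonReflecting S (succ κ).ord) {α : Ordinal.{v}} (hα : α < (succ κ).ord)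
    (hlim : IsSuccLimit α) :
    ∃ C : Set Ordinal.{v}, (∀ γ ∈ C, γ < α) ∧ (∀ β < α, ∃ γ ∈ C, β ≤ γ) ∧
      ∀ ζ ∈ S, ζ < α → ∃ γ₀ < ζ, ∀ γ ∈ C, γ < ζ → γ ≤ γ₀ := by
  have hpos : ∀ ζ ∈ S, 0 < ζ := fun ζ hζ =>
    (isSuccLimit_of_mem_cofinalityClass hlam (hS hζ)).bot_lt
  rcases lt_or_ge ℵ₀ α.cof with hcof | hcof
  -- A club disjoint from S contains its own limit points below α, so none of them is in S.
  · obtain ⟨t, ht, hd⟩ := not_isStationary_iff.1 (hnr α hα hcof)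
    refine ⟨Subtype.val '' t, ?_, fun β hβ => ?_, fun ζ hζ hζα => ?_⟩
    · rintro _ ⟨γ, -, rfl⟩
      exact γ.2
    · obtain ⟨γ, hγ, hle⟩ := ht.isCofinal ⟨β, hβ⟩
      exact ⟨γ, ⟨γ, hγ, rfl⟩, hle⟩
    · by_contra! hacc
      refine Set.disjoint_left.1 hd
        (show (⟨ζ, hζα⟩ : Set.Iio α) ∈ (Subtype.val ⁻¹' S : Set (Set.Iio α)) from hζ) ?_
      refine ht.isLUB_mem (t := {x | x ∈ t ∧ x.1 < ζ}) (fun x hx => hx.1) ?_ ⟨?_, ?_⟩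
      · obtain ⟨_, ⟨γ, hγ, rfl⟩, h, -⟩ := hacc 0 (hpos ζ hζ)
        exact ⟨γ, hγ, h⟩
      · exact fun x hx => hx.2.le
      · intro b hb
        by_contra! hlt
        obtain ⟨_, ⟨γ, hγ, rfl⟩, h, h'⟩ := hacc b.1 hlt
        exact (show γ ≤ b from hb ⟨hγ, h⟩).not_gt h'
  -- In countable cofinality a weakly increasing cofinal ω-sequence has only finitely many indices
  -- with value below a given ζ < α.
  · obtain ⟨s, hs, hcard⟩ := Order.exists_cof_eq (Set.Iio α)
    have hs1 : s.Countable := by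
      rw [← Cardinal.le_aleph0_iff_set_countable, hcard, Ordinal.cof_Iio, ← Ordinal.lift_cof,
        Cardinal.lift_le_aleph0]
      exact hcof
    have hne : Nonempty (Set.Iio α) := ⟨⟨0, hlim.bot_lt⟩⟩
    obtain ⟨f, hf⟩ := hs1.exists_eq_range hs.nonempty
    refine ⟨Set.range fun n => (partialSups f n : Set.Iio α).1, ?_, fun β hβ => ?_,
      fun ζ hζ hζα => ?_⟩
    · rintro _ ⟨n, rfl⟩
      exact (partialSups f n).2
    · obtain ⟨γ, hγ, hle⟩ := hs ⟨β, hβ⟩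
      rw [hf] at hγ
      obtain ⟨n, rfl⟩ := hγ
      exact ⟨_, ⟨n, rfl⟩, hle.trans (le_partialSups f n)⟩
    · obtain ⟨γ, hγ, hle⟩ := hs ⟨ζ, hζα⟩
      rw [hf] at hγ
      obtain ⟨n, rfl⟩ := hγ
      classical
      refine ⟨((Finset.range n).filter fun m => (partialSups f m : Set.Iio α).1 < ζ).sup
        fun m => (partialSups f m : Set.Iio α).1, ?_, ?_⟩
      · rw [Finset.sup_lt_iff (hpos ζ hζ)]
        intro m hm
        exact (Finset.mem_filter.1 hm).2
      · rintro _ ⟨m, rfl⟩ hm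
        refine Finset.le_sup (f := fun m => (partialSups f m : Set.Iio α).1)
          (Finset.mem_filter.2 ⟨Finset.mem_range.2 ?_, hm⟩)
        by_contra! hnm
        refine hm.not_ge (le_trans hle ?_)
        exact (le_partialSups f n).trans ((partialSups f).monotone hnm)

/-- Every bounded part of a ladder system on a non-reflecting set can be well-ordered so that every
ladder meets the union of the preceding ladders in a bounded set. -/
theorem exists_rank (hlam : ℵ₀ ≤ lam) (hS : S ⊆ cofinalityClass (succ κ) lam)
    (hnr : NonReflecting S (succ κ).ord) (hc : IsLadderSystem lam S c) (α : Ordinal.{v})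
    (hα : α < (succ κ).ord) :
    ∃ ρ : Ordinal.{v} → Ordinal.{v}, Set.InjOn ρ (S ∩ Set.Iio α) ∧
      ∀ ξ ∈ S, ξ < α → ∃ γ < lam.ord, ∀ ζ ∈ S, ζ < α → ρ ζ < ρ ξ →
        ∀ δ < lam.ord, c ξ δ = c ζ δ → δ < γ := by
  classical
  induction α using WellFoundedLT.induction with
  | ind α ih =>
  rcases Ordinal.zero_or_succ_or_isSuccLimit α with rfl | ⟨β, rfl⟩ | hlim
  · exact ⟨id, fun _ _ _ _ h => h, fun ξ _ h => (not_lt_bot h).elim⟩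
  · obtain ⟨ρ, hρ, hb⟩ := ih β (lt_succ β) ((lt_succ β).trans hα)
    have hlt : ∀ {ζ}, ζ < succ β → ζ ≠ β → ζ < β := fun h hne =>
      lt_of_le_of_ne (lt_succ_iff.1 h) hne
    by_cases hβ : β ∈ S
    -- The new ladder goes first: it might meet the union of the others in an unbounded set, but
    -- each of them meets this single ladder in a bounded one.
    · refine ⟨fun ζ => if ζ = β then 0 else 1 + ρ ζ, ?_, fun ξ hξ hξα => ?_⟩
      · rintro ζ ⟨hζ, hζα⟩ ξ ⟨hξ, hξα⟩ h
        by_cases h1 : ζ = β <;> by_cases h2 : ξ = β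
        · rw [h1, h2]
        · simp only [h1, h2, if_true, if_false] at h
          exact ((zero_lt_one.trans_le le_self_add).ne h).elim
        · simp only [h1, h2, if_true, if_false] at h
          exact ((zero_lt_one.trans_le le_self_add).ne' h).elim
        · simp only [h1, h2, if_false, add_right_inj] at h
          exact hρ ⟨hζ, hlt hζα h1⟩ ⟨hξ, hlt hξα h2⟩ h
      · by_cases h : ξ = β
        · refine ⟨0, (Cardinal.isSuccLimit_ord hlam).bot_lt, fun ζ _ _ hlt' => ?_⟩
          simp [h] at hlt'
        · obtain ⟨γ₁, hγ₁, h₁⟩ := hb ξ hξ (hlt hξα h)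
          obtain ⟨γ₂, hγ₂, h₂⟩ := hc.exists_agree_lt hβ hξ (Ne.symm h)
          refine ⟨max γ₁ γ₂, max_lt hγ₁ hγ₂, fun ζ hζ hζα hr δ hδ heq => ?_⟩
          by_cases h' : ζ = β
          · subst h'
            exact lt_max_of_lt_right (h₂ δ hδ heq)
          · simp only [h, h', if_false, add_lt_add_iff_left] at hr
            exact lt_max_of_lt_left (h₁ ζ hζ (hlt hζα h') hr δ hδ heq)
    · have hne : ∀ {ζ}, ζ ∈ S → ζ ≠ β := fun hζ h => hβ (h ▸ hζ)
      refine ⟨ρ, fun ζ hζ ξ hξ h => hρ ⟨hζ.1, hlt hζ.2 (hne hζ.1)⟩ ⟨hξ.1, hlt hξ.2 (hne hξ.1)⟩ h,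
        fun ξ hξ hξα => ?_⟩
      obtain ⟨γ, hγ, h⟩ := hb ξ hξ (hlt hξα (hne hξ))
      exact ⟨γ, hγ, fun ζ hζ hζα => h ζ hζ (hlt hζα (hne hζ))⟩
  · obtain ⟨C, hCα, hCcof, hCacc⟩ := exists_cofinal_not_accumulating hlam hS hnr hα hlim
    have hρ : ∀ β, ∃ ρ : Ordinal.{v} → Ordinal.{v}, β < α → Set.InjOn ρ (S ∩ Set.Iio β) ∧
        ∀ ξ ∈ S, ξ < β → ∃ γ < lam.ord, ∀ ζ ∈ S, ζ < β → ρ ζ < ρ ξ →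
          ∀ δ < lam.ord, c ξ δ = c ζ δ → δ < γ := by
      intro β
      by_cases hβ : β < α
      · obtain ⟨ρ, h⟩ := ih β hβ (hβ.trans hα)
        exact ⟨ρ, fun _ => h⟩
      · exact ⟨id, fun h => (hβ h).elim⟩
    choose ρ hρ using hρ
    obtain ⟨Ω, hΩ⟩ : ∃ Ω : Ordinal.{v}, ∀ β < α, ∀ ζ < α, ρ β ζ < Ω := by
      obtain ⟨Ω, hΩ⟩ := Ordinal.bddAbove_of_small
        (s := Set.range fun x : Set.Iio α × Set.Iio α => ρ x.1 x.2)
      exact ⟨succ Ω, fun β hβ ζ hζ => lt_succ_iff.2 (hΩ ⟨(⟨β, hβ⟩, ⟨ζ, hζ⟩), rfl⟩)⟩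
    -- C cuts α into blocks, ordered by their tops n ζ; Ω exceeds all ranks, so blocks do not
    -- overlap. Inside a block the order is given by ρ (n ζ + 1), with + 1 because ζ = n ζ is
    -- possible.
    let n : Ordinal.{v} → Ordinal.{v} := fun ζ => sInf {γ | γ ∈ C ∧ ζ ≤ γ}
    have hn : ∀ ζ < α, n ζ ∈ C ∧ ζ ≤ n ζ := fun ζ hζ => csInf_mem (hCcof ζ hζ)
    have hn' : ∀ ζ γ, γ ∈ C → ζ ≤ γ → n ζ ≤ γ := fun ζ γ h h' => csInf_le' ⟨h, h'⟩
    have hnα : ∀ ζ < α, n ζ + 1 < α := fun ζ hζ => hlim.add_one_lt (hCα _ (hn ζ hζ).1)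
    have hζn : ∀ ζ < α, ζ < n ζ + 1 := fun ζ hζ => lt_add_one_iff.2 (hn ζ hζ).2
    let r : Ordinal.{v} → Ordinal.{v} := fun ζ => Ω * n ζ + ρ (n ζ + 1) ζ
    have hrlt : ∀ ζ < α, ∀ ξ < α, n ζ < n ξ → r ζ < r ξ := by
      intro ζ hζ ξ hξ h
      calc r ζ < Ω * n ζ + Ω := by
            simpa [r] using hΩ _ (hnα ζ hζ) ζ hζ
        _ = Ω * (n ζ + 1) := by rw [mul_add_one]
        _ ≤ Ω * n ξ := by gcongr; exact add_one_le_of_lt h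
        _ ≤ r ξ := le_self_add
    refine ⟨r, fun ζ hζ ξ hξ h => ?_, fun ξ hξ hξα => ?_⟩
    · have hnn : n ζ = n ξ := by
        rcases lt_trichotomy (n ζ) (n ξ) with h' | h' | h'
        · exact ((hrlt ζ hζ.2 ξ hξ.2 h').ne h).elim
        · exact h'
        · exact ((hrlt ξ hξ.2 ζ hζ.2 h').ne' h).elim
      simp only [r, hnn, add_right_inj] at h
      exact (hρ _ (hnα ξ hξ.2)).1 ⟨hζ.1, hnn ▸ hζn ζ hζ.2⟩ ⟨hξ.1, hζn ξ hξ.2⟩ h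
    · obtain ⟨γ₁, hγ₁, h₁⟩ := (hρ _ (hnα ξ hξα)).2 ξ hξ (hζn ξ hξα)
      obtain ⟨γ₀, hγ₀, h₀⟩ := hCacc ξ hξ hξα
      obtain ⟨γ₂, hγ₂, h₂⟩ := hc.unbounded ξ hξ γ₀ hγ₀
      refine ⟨max γ₁ γ₂, max_lt hγ₁ hγ₂, fun ζ hζ hζα hr δ hδ heq => ?_⟩
      rcases lt_trichotomy (n ζ) (n ξ) with h | h | h
      -- A ladder from an earlier block stays below n ζ ≤ γ₀, whereas c ξ is above γ₀ from γ₂ on.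
      · refine lt_max_of_lt_right ?_
        have h3 : n ζ < ξ := by
          by_contra! hle
          exact h.not_ge (hn' ξ _ (hn ζ hζα).1 hle)
        have h4 := h₀ _ (hn ζ hζα).1 h3
        by_contra! hle
        have h5 := (hc.strictMonoOn ξ hξ).monotoneOn hγ₂ hδ hle
        rw [heq] at h5
        exact ((h₂.trans_le h5).trans (hc.lt ζ hζ δ hδ)).not_ge ((hn ζ hζα).2.trans h4)
      · simp only [r, h, add_lt_add_iff_left] at hr
        exact lt_max_of_lt_left (h₁ ζ hζ (h ▸ hζn ζ hζα) hr δ hδ heq)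
      · exact (hr.not_gt (hrlt ξ hξα ζ hζα h)).elim

/-- A stationary set contains a closure point of any given function on `κ⁺`. -/
theorem exists_mem_closed_of_stationaryIn (hκ : ℵ₀ ≤ κ) (hst : StationaryIn S (succ κ).ord)
    (h : Ordinal.{v} → Ordinal.{v}) (hh : ∀ β < (succ κ).ord, h β < (succ κ).ord) :
    ∃ η ∈ S, η < (succ κ).ord ∧ ∀ β < η, h β ≤ η := by
  have hcof : (succ κ).ord.cof = succ κ := (isRegular_succ hκ).cof_ord
  have hclub : IsClub {γ : Set.Iio (succ κ).ord | ∀ β < γ.1, h β ≤ γ.1} := by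
    constructor
    · intro d hd hne _ a ha β hβ
      obtain ⟨b, hb, hlt⟩ := (lt_isLUB_iff ha (b := ⟨β, hβ.trans a.2⟩)).1 hβ
      exact (hd hb β hlt).trans (ha.1 hb)
    · rintro ⟨a, ha⟩
      -- Iterating `g` ω times from `a` reaches a closure point, which is below κ⁺ by regularity.
      let g : Ordinal.{v} → Ordinal.{v} := fun γ => max γ (⨆ β : Set.Iio γ, h β)
      have hg : ∀ γ < (succ κ).ord, g γ < (succ κ).ord := by
        intro γ hγ
        refine max_lt hγ (Ordinal.lift_iSup_lt_of_lt_cof ?_ fun β => hh β (β.2.trans hγ))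
        rw [← Ordinal.lift_cof, hcof, Cardinal.mk_Iio_ordinal]
        rw [Cardinal.lift_lift, Cardinal.lift_lt]
        exact Cardinal.lt_ord.1 hγ
      let s : ℕ → Ordinal.{v} := fun n => g^[n] a
      have hs : ∀ n, s (n + 1) = g (s n) := fun n => Function.iterate_succ_apply' g n a
      have hs' : ∀ n, s n < (succ κ).ord := by
        intro n
        induction n with
        | zero => exact ha
        | succ n ih => rw [hs]; exact hg _ ih
      have hsup : ⨆ n, s n < (succ κ).ord := by
        refine Ordinal.lift_iSup_lt_of_lt_cof ?_ hs'
        rw [← Ordinal.lift_cof, hcof]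
        simpa using lt_succ_of_le hκ
      refine ⟨⟨⨆ n, s n, hsup⟩, fun β hβ => ?_, Ordinal.le_iSup s 0⟩
      obtain ⟨n, hn⟩ := Ordinal.lt_iSup_iff.1 hβ
      refine le_trans ?_ (Ordinal.le_iSup s (n + 1))
      rw [hs]
      exact le_max_of_le_right (Ordinal.le_iSup (fun β : Set.Iio (s n) => h β) ⟨β, hn⟩)
  obtain ⟨η, hη, hη'⟩ := hst hclub
  exact ⟨η, hη, η.2, hη'⟩

end Ladders

/-! ### Reduction to a template of bounded size -/

section SmallTemplate

/-- Closing off an element under a set-valued function with small values gives a small set. -/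
theorem exists_closed_mk_le {ι : Type v} {κ : Cardinal.{v}} (hκ : ℵ₀ ≤ κ) (E : ι → Set ι)
    (hE : ∀ j, #(E j) ≤ κ) (j : ι) : ∃ J : Set ι, j ∈ J ∧ #J ≤ κ ∧ ∀ a ∈ J, E a ⊆ J := by
  let step : Set ι → Set ι := fun A => A ∪ ⋃ a : A, E a
  let s : ℕ → Set ι := fun n => step^[n] {j}
  have hs : ∀ n, s (n + 1) = step (s n) := fun n => Function.iterate_succ_apply' step n _
  have hcard : ∀ n, #(s n) ≤ κ := by
    intro n
    induction n with
    | zero => simpa [s] using one_lt_aleph0.le.trans hκ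
    | succ n ih =>
      rw [hs]
      refine (mk_union_le _ _).trans (add_le_of_le hκ ih ?_)
      refine (mk_iUnion_le _).trans (mul_le_of_le hκ ih ?_)
      exact ciSup_le' fun a => hE a
  refine ⟨⋃ n : ULift.{v} ℕ, s n.down, Set.mem_iUnion.2 ⟨⟨0⟩, rfl⟩, ?_, ?_⟩
  · refine (mk_iUnion_le _).trans (mul_le_of_le hκ (by simpa using hκ) ?_)
    exact ciSup_le' fun n => hcard n.down
  · intro a ha
    obtain ⟨⟨n⟩, hn⟩ := Set.mem_iUnion.1 ha
    refine Set.Subset.trans ?_ (Set.subset_iUnion _ ⟨n + 1⟩)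
    change E a ⊆ s (n + 1)
    rw [hs]
    exact Set.subset_union_of_subset_right (Set.subset_iUnion (fun a : s n => E a) ⟨a, hn⟩) _

variable {R : Type u} [Ring R] {X : Type v} [AddCommGroup X] [Module R X] {ι : Type v}

theorem Finsupp.map_mem_supported_of_single {Q : Submodule R (ι →₀ X)} {J : Set ι}
    {p : (ι →₀ X) →ₗ[R] (ι →₀ X)} {G : Set X} (hG : Submodule.span R G = ⊤)
    (h : ∀ j ∈ J, ∀ g ∈ G, p (Finsupp.single j g) ∈ Q) {x : ι →₀ X}
    (hx : x ∈ Finsupp.supported X R J) : p x ∈ Q := by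
  have key : ∀ j ∈ J, ∀ y, p (Finsupp.single j y) ∈ Q := by
    intro j hj y
    have : Submodule.span R G ≤ Q.comap (p ∘ₗ Finsupp.lsingle j) :=
      Submodule.span_le.2 fun g hg => h j hj g hg
    rw [hG] at this
    exact this (Submodule.mem_top (x := y))
  rw [← Finsupp.sum_single x, Finsupp.sum, map_sum]
  exact Submodule.sum_mem _ fun j hj => key j (hx hj) _

section SubtypeDomain

variable {K : Set ι}

theorem Finsupp.lmapDomain_val_apply (y : K →₀ X) (i : K) :
    Finsupp.lmapDomain X R (Subtype.val : K → ι) y i = y i :=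
  Finsupp.mapDomain_apply Subtype.val_injective _ _

theorem Finsupp.lmapDomain_val_apply_of_notMem (y : K →₀ X) {i : ι} (hi : i ∉ K) :
    Finsupp.lmapDomain X R (Subtype.val : K → ι) y i = 0 :=
  Finsupp.mapDomain_of_notMem_range _ _ (by simpa using hi)

theorem Finsupp.sub_lmapDomain_mem_supported {J J' : Set ι} {x : ι →₀ X}
    (hx : x ∈ Finsupp.supported X R J') :
    x - Finsupp.lmapDomain X R Subtype.val
      ((Finsupp.lsubtypeDomain (J' \ J) : (ι →₀ X) →ₗ[R] _) x) ∈ Finsupp.supported X R J := by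
  rw [Finsupp.mem_supported'] at hx ⊢
  intro i hi
  rw [Finsupp.sub_apply, sub_eq_zero]
  by_cases hK : i ∈ J' \ J
  · exact (Finsupp.lmapDomain_val_apply (R := R)
      (Finsupp.lsubtypeDomain (R := R) (J' \ J) x) ⟨i, hK⟩).symm
  · rw [hx i fun h => hK ⟨h, hi⟩,
      Finsupp.lmapDomain_val_apply_of_notMem (R := R) (K := J' \ J) _ hK]

theorem Finsupp.lsubtypeDomain_eq_zero {J J' : Set ι} {x : ι →₀ X}
    (hx : x ∈ Finsupp.supported X R J) :
    (Finsupp.lsubtypeDomain (J' \ J) : (ι →₀ X) →ₗ[R] _) x = 0 := by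
  rw [Finsupp.mem_supported'] at hx
  ext i
  exact hx i i.2.2

end SubtypeDomain

/-- One step of the extension of a retraction. -/
theorem exists_extension_of_isComplemented {N : Submodule R (ι →₀ X)} {J J' : Set ι} (hJ : J ⊆ J')
    (hcompl : IsComplemented ((N ⊓ Finsupp.supported X R J').map
      (Finsupp.lsubtypeDomain (J' \ J) : (ι →₀ X) →ₗ[R] _)))
    (s : (ι →₀ X) →ₗ.[R] (ι →₀ X)) (hs : s.domain = Finsupp.supported X R J)
    (hsN : ∀ x, s x ∈ N) (hs' : ∀ x : s.domain, (x : ι →₀ X) ∈ N → s x = x) :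
    ∃ s' : (ι →₀ X) →ₗ.[R] (ι →₀ X), s ≤ s' ∧ s'.domain = Finsupp.supported X R J' ∧
      (∀ x, s' x ∈ N) ∧ ∀ x : s'.domain, (x : ι →₀ X) ∈ N → s' x = x := by
  obtain ⟨t, ht, ht'⟩ := Submodule.exists_retraction hcompl
  set res : (ι →₀ X) →ₗ[R] (↥(J' \ J) →₀ X) := Finsupp.lsubtypeDomain (J' \ J)
  set inc : (↥(J' \ J) →₀ X) →ₗ[R] (ι →₀ X) := Finsupp.lmapDomain X R Subtype.val
  set N' := N ⊓ Finsupp.supported X R J'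
  have hsub : ∀ x ∈ Finsupp.supported X R J', x - inc (res x) ∈ Finsupp.supported X R J :=
    fun x hx => Finsupp.sub_lmapDomain_mem_supported hx
  have hres0 : ∀ x ∈ Finsupp.supported X R J, res x = 0 :=
    fun x hx => Finsupp.lsubtypeDomain_eq_zero hx
  let σ₀ : (ι →₀ X) →ₗ.[R] (ι →₀ X) := ⟨N', N'.subtype⟩
  have hagree : ∀ (x : s.domain) (y : σ₀.domain), (x : ι →₀ X) = y → s x = σ₀ y := by
    intro x y hxy
    rw [hs' x (by rw [hxy]; exact y.2.1), hxy]
    rfl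
  let σ := s.sup σ₀ hagree
  have hσ : ∀ (x : s.domain) (y : σ₀.domain) (z : σ.domain), (x : ι →₀ X) + y = z →
      σ z = s x + y := fun x y z h => LinearPMap.sup_apply hagree x y z h
  have hσd : σ.domain = Finsupp.supported X R J ⊔ N' := by
    rw [← hs]; rfl
  -- `w` replaces the layer component of x by its projection under `t`. It fixes N' and everything
  -- supported on J, and maps into the domain of σ, so σ ∘ w is the desired extension.
  let w : (ι →₀ X) →ₗ[R] (ι →₀ X) := LinearMap.id - inc ∘ₗ res + inc ∘ₗ t ∘ₗ res
  have hw : ∀ x, w x = x - inc (res x) + inc (t (res x)) := fun x => rfl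
  have hwmem : ∀ x ∈ Finsupp.supported X R J', w x ∈ σ.domain := by
    intro x hx
    rw [hw, hσd]
    refine add_mem (Submodule.mem_sup_left (hsub x hx)) ?_
    obtain ⟨n, hn, hn'⟩ := ht (res x)
    rw [← hn', ← sub_sub_cancel n (inc (res n))]
    exact sub_mem (Submodule.mem_sup_right hn) (Submodule.mem_sup_left (hsub n hn.2))
  let s' : (ι →₀ X) →ₗ.[R] (ι →₀ X) := ⟨Finsupp.supported X R J',
    σ.toFun ∘ₗ (w ∘ₗ (Finsupp.supported X R J').subtype).codRestrict σ.domain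
      fun x => hwmem x x.2⟩
  have hs'σ : ∀ x : s'.domain, s' x = σ ⟨w x, hwmem x x.2⟩ := fun x => rfl
  refine ⟨s', ⟨?_, ?_⟩, rfl, fun x => ?_, fun x hx => ?_⟩
  · rw [hs]
    exact Finsupp.supported_mono hJ
  · intro x y hxy
    have hy : w y = y := by
      rw [hw, ← hxy, hres0 x (hs ▸ x.2)]
      simp
    rw [hs'σ, hσ x 0 ⟨w y, hwmem y y.2⟩ (by simp [hy, hxy])]
    simp
  · rw [hs'σ]
    obtain ⟨a, ha, b, hb, hab⟩ := Submodule.mem_sup.1 (hwmem x x.2)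
    rw [hσ ⟨a, ha⟩ ⟨b, hb⟩ ⟨w x, hwmem x x.2⟩ hab]
    exact add_mem (hsN _) (show b ∈ N' from hb).1
  · have hw' : w x = x := by
      rw [hw, ht' (res x) ⟨x, ⟨hx, x.2⟩, rfl⟩]
      simp
    rw [hs'σ, hσ 0 ⟨x, ⟨hx, x.2⟩⟩ ⟨w x, hwmem x x.2⟩ (by simp [hw'])]
    simp

/-- A submodule all of whose restrictions to layers of closed sets are complemented is itself
complemented. -/
theorem exists_layer_not_isComplemented {κ : Cardinal.{v}} (hκ : ℵ₀ ≤ κ)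
    {N : Submodule R (ι →₀ X)} (hN : ¬ IsComplemented N) (E : ι → Set ι)
    (hE : ∀ j, #(E j) ≤ κ) :
    ∃ J J' : Set ι, (∀ a ∈ J, E a ⊆ J) ∧ (∀ a ∈ J', E a ⊆ J') ∧ J ⊆ J' ∧ #↥(J' \ J) ≤ κ ∧
      ¬ IsComplemented ((N ⊓ Finsupp.supported X R J').map
        (Finsupp.lsubtypeDomain (J' \ J) : (ι →₀ X) →ₗ[R] _)) := by
  by_contra! hcon
  -- If all layers split, Zorn's lemma gives a maximal partial retraction into N defined on a closed
  -- set of coordinates. It is total, since otherwise adjoining a closed set of size at most κ would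
  -- extend it.
  let 𝒵 : Set ((ι →₀ X) →ₗ.[R] (ι →₀ X)) := {s | (∃ J : Set ι, (∀ a ∈ J, E a ⊆ J) ∧
    s.domain = Finsupp.supported X R J) ∧ (∀ x, s x ∈ N) ∧
      ∀ x : s.domain, (x : ι →₀ X) ∈ N → s x = x}
  have hne : (⟨Finsupp.supported X R ∅, 0⟩ : (ι →₀ X) →ₗ.[R] (ι →₀ X)) ∈ 𝒵 := by
    refine ⟨⟨∅, by simp, rfl⟩, fun x => ?_, fun x hx => ?_⟩
    · exact zero_mem N
    · have h0 := x.2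
      simp only [Finsupp.supported_empty, Submodule.mem_bot] at h0
      rw [h0]
      rfl
  obtain ⟨s, -, hmax⟩ := zorn_le_nonempty₀ 𝒵 (fun C hC hchain y hy => by
    have hdir : DirectedOn (· ≤ ·) C := hchain.directedOn
    have hCne : C.Nonempty := ⟨y, hy⟩
    refine ⟨LinearPMap.sSup C hdir, ⟨?_, fun x => ?_, fun x hx => ?_⟩,
      fun z hz => LinearPMap.le_sSup hdir hz⟩
    · choose J hJ hJ' using fun s : C => (hC s.2).1
      refine ⟨⋃ s, J s, fun a ha => ?_, ?_⟩
      · obtain ⟨s, hs⟩ := Set.mem_iUnion.1 ha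
        exact (hJ s a hs).trans (Set.subset_iUnion J s)
      · rw [LinearPMap.domain_sSup, Finsupp.supported_iUnion, sSup_image']
        exact iSup_congr hJ'
    · obtain ⟨s, hs, hxs⟩ := (LinearPMap.mem_domain_sSup_iff hCne hdir).1 x.2
      have := LinearPMap.sSup_apply hdir hs ⟨x, hxs⟩
      rw [show x = ⟨x.1, (LinearPMap.le_sSup hdir hs).1 hxs⟩ from rfl, this]
      exact (hC hs).2.1 _
    · obtain ⟨s, hs, hxs⟩ := (LinearPMap.mem_domain_sSup_iff hCne hdir).1 x.2
      have := LinearPMap.sSup_apply hdir hs ⟨x, hxs⟩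
      rw [show x = ⟨x.1, (LinearPMap.le_sSup hdir hs).1 hxs⟩ from rfl, this]
      exact (hC hs).2.2 _ hx) _ hne
  obtain ⟨⟨⟨J, hJ, hsJ⟩, hsN, hs'⟩, hmax⟩ := hmax
  have htop : s.domain = ⊤ := by
    rw [eq_top_iff, ← Finsupp.iSup_lsingle_range]
    refine iSup_le fun j => ?_
    rintro _ ⟨y, rfl⟩
    by_contra hj
    obtain ⟨A, hjA, hA, hAE⟩ := exists_closed_mk_le hκ E hE j
    have hcl : ∀ a ∈ J ∪ A, E a ⊆ J ∪ A := by
      rintro a (ha | ha)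
      · exact Set.subset_union_of_subset_left (hJ a ha) _
      · exact Set.subset_union_of_subset_right (hAE a ha) _
    have hsub : J ⊆ J ∪ A := Set.subset_union_left
    obtain ⟨s', hle, hd, hs'N, hs''⟩ := exists_extension_of_isComplemented hsub
      (hcon J (J ∪ A) hJ hcl hsub ((mk_le_mk_of_subset (by simp)).trans hA)) s hsJ hsN hs'
    refine hj ((hmax ⟨⟨_, hcl, hd⟩, hs'N, hs''⟩ hle).1 ?_)
    rw [hd]
    exact Finsupp.single_mem_supported R y (Or.inr hjA)
  refine hN (Submodule.isComplemented_of_retraction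
    (s.toFun ∘ₗ LinearMap.id.codRestrict s.domain fun x => htop ▸ Submodule.mem_top)
    (fun x => hsN _) fun x hx => hs' ⟨x, htop ▸ Submodule.mem_top⟩ hx)

/-- A template for `Add(X)` yields a template whose ambient module is a direct sum of at most `κ`
copies of `X`. -/
theorem IsTemplate.exists_small {κ lam : Cardinal.{v}} (hlam : ℵ₀ ≤ lam) (hlt : lam < κ)
    (hX : IsLTGenerated R κ X) {L : Type v} [AddCommGroup L] [Module R L] {N : Submodule R L}
    {F : Ordinal.{v} → Submodule R L} (hT : IsTemplate lam (AddClass R X) L N F) :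
    ∃ (K : Type v) (F' : Ordinal.{v} → Submodule R (K →₀ X)), #K ≤ κ ∧
      (∀ α β, α ≤ β → β < lam.ord → F' α ≤ F' β) ∧
      (∀ α < lam.ord, IsSuccLimit α → F' α ≤ ⨆ β < α, F' β) ∧
      (∀ α < lam.ord, IsComplemented (F' α)) ∧ ¬ IsComplemented (⨆ α < lam.ord, F' α) := by
  have hκ : ℵ₀ ≤ κ := hlam.trans hlt.le
  obtain ⟨ι, f, g, hfg⟩ := hT.mem_class.exists_retract
  obtain ⟨G, hGκ, hG⟩ := hX
  have hp : ∀ α : Ordinal.{v}, ∃ p : (ι →₀ X) →ₗ[R] (ι →₀ X), α < lam.ord →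
      (∀ x, p x ∈ (F α).map f) ∧ ∀ x ∈ (F α).map f, p x = x := by
    intro α
    by_cases hα : α < lam.ord
    · obtain ⟨p, hp, hp'⟩ := Submodule.exists_retraction (hT.isComplemented α hα)
      refine ⟨f ∘ₗ p ∘ₗ g, fun _ => ⟨fun x => ⟨_, hp _, rfl⟩, ?_⟩⟩
      rintro _ ⟨x, hx, rfl⟩
      simp [hfg, hp' x hx]
    · exact ⟨0, fun h => (hα h).elim⟩
  choose p hp using hp
  have hN : ¬ IsComplemented (N.map f) := by
    intro h
    obtain ⟨q, hq, hq'⟩ := Submodule.exists_retraction h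
    refine hT.not_isComplemented
      (Submodule.isComplemented_of_retraction (g ∘ₗ q ∘ₗ f) (fun x => ?_) fun x hx => ?_)
    · obtain ⟨n, hn, hn'⟩ := hq (f x)
      simpa [← hn', hfg] using hn
    · simp [hq' (f x) ⟨x, hx, rfl⟩, hfg]
  -- Vectors supported on an `E`-closed set are preserved by every projection `p α`, so each `p α`
  -- induces a projection on the layer between two closed sets.
  let E : ι → Set ι := fun j => ⋃ a : lam.ord.ToType × G,
    ((p (Ordinal.ToType.mk.symm a.1 : Set.Iio lam.ord) (Finsupp.single j a.2.1)).support : Set ι)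
  have hE : ∀ j, #(E j) ≤ κ := by
    intro j
    refine (mk_iUnion_le _).trans (mul_le_of_le hκ ?_ ?_)
    · rw [mk_prod, Cardinal.lift_id, Cardinal.lift_id, mk_toType, card_ord]
      exact mul_le_of_le hκ hlt.le hGκ.le
    · exact ciSup_le' fun a => ((Cardinal.mk_le_aleph0_iff).2
        (Finset.countable_toSet _).to_subtype).trans hκ
  obtain ⟨J, J', hJ, hJ', hsub, hcard, hnot⟩ := exists_layer_not_isComplemented hκ hN E hE
  have hpJ : ∀ {J : Set ι}, (∀ a ∈ J, E a ⊆ J) → ∀ α < lam.ord, ∀ x ∈ Finsupp.supported X R J,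
      p α x ∈ Finsupp.supported X R J := by
    intro J hJ α hα x hx
    refine Finsupp.map_mem_supported_of_single hG (fun j hj y hy => ?_) hx
    refine Set.Subset.trans ?_ (hJ j hj)
    have := Set.subset_iUnion (fun a : lam.ord.ToType × G =>
      ((p (Ordinal.ToType.mk.symm a.1 : Set.Iio lam.ord) (Finsupp.single j a.2.1)).support : Set ι))
      (Ordinal.ToType.mk ⟨α, hα⟩, ⟨y, hy⟩)
    simpa using this
  set res : (ι →₀ X) →ₗ[R] (↥(J' \ J) →₀ X) := Finsupp.lsubtypeDomain (J' \ J)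
  set inc : (↥(J' \ J) →₀ X) →ₗ[R] (ι →₀ X) := Finsupp.lmapDomain X R Subtype.val
  have hincmem : ∀ y, inc y ∈ Finsupp.supported X R J' := by
    intro y
    rw [Finsupp.mem_supported']
    exact fun i hi => Finsupp.lmapDomain_val_apply_of_notMem _ fun h => hi h.1
  have hsubJ : ∀ x ∈ Finsupp.supported X R J', x - inc (res x) ∈ Finsupp.supported X R J :=
    fun x hx => Finsupp.sub_lmapDomain_mem_supported hx
  have hres0 : ∀ x ∈ Finsupp.supported X R J, res x = 0 :=
    fun x hx => Finsupp.lsubtypeDomain_eq_zero hx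
  let F' : Ordinal.{v} → Submodule R (↥(J' \ J) →₀ X) := fun α =>
    ((F α).map f ⊓ Finsupp.supported X R J').map res
  refine ⟨↥(J' \ J), F', hcard, fun α β hαβ hβ => ?_, fun α hα hlim => ?_, fun α hα => ?_, ?_⟩
  · exact Submodule.map_mono (inf_le_inf_right _
      (Submodule.map_mono (hT.monotoneOn (hαβ.trans_lt hβ) hβ hαβ)))
  · rintro _ ⟨_, ⟨⟨x, hx, rfl⟩, hx'⟩, rfl⟩
    have hx₀ : x ∈ (F α : Set L) := hx
    rw [hT.continuous α hα hlim] at hx₀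
    obtain ⟨β, hβ⟩ := Set.mem_iUnion.1 hx₀
    exact (le_iSup₂_of_le (f := fun β (_ : β < α) => F' β) β.1 β.2 le_rfl)
      ⟨f x, ⟨⟨x, hβ, rfl⟩, hx'⟩, rfl⟩
  · refine Submodule.isComplemented_of_retraction (res ∘ₗ p α ∘ₗ inc) (fun y => ?_) ?_
    · exact ⟨_, ⟨(hp α hα).1 _, hpJ hJ' α hα _ (hincmem y)⟩, rfl⟩
    · rintro _ ⟨z, ⟨hz, hz'⟩, rfl⟩
      have h1 := hres0 _ (hpJ hJ α hα _ (hsubJ z hz'))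
      rw [map_sub, map_sub, (hp α hα).2 z hz, sub_eq_zero] at h1
      exact h1.symm
  · convert hnot using 2
    refine le_antisymm (iSup₂_le fun α hα => ?_) ?_
    · refine Submodule.map_mono (inf_le_inf_right _ (Submodule.map_mono fun x hx => ?_))
      rw [← SetLike.mem_coe, hT.union]
      exact Set.mem_iUnion.2 ⟨⟨α, hα⟩, hx⟩
    · rintro _ ⟨_, ⟨⟨x, hx, rfl⟩, hx'⟩, rfl⟩
      have hx₀ : x ∈ (N : Set L) := hx
      rw [hT.union] at hx₀
      obtain ⟨β, hβ⟩ := Set.mem_iUnion.1 hx₀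
      exact (le_iSup₂_of_le (f := fun β (_ : β < lam.ord) => F' β) β.1 β.2 le_rfl)
        ⟨f x, ⟨⟨x, hβ, rfl⟩, hx'⟩, rfl⟩

end SmallTemplate

/-! ### Gluing a filtration along a ladder system -/

section LadderGluing

variable {R : Type u} [Ring R]

/-- The successor terms indexed by a bounded set sum up to a complemented submodule. -/
theorem isComplemented_partialSup {L : Type v} [AddCommGroup L] [Module R L]
    {F : Ordinal.{v} → Submodule R L} {o : Ordinal.{v}} (ho : IsSuccLimit o)
    (hmono : ∀ α β, α ≤ β → β < o → F α ≤ F β)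
    (hcont : ∀ α < o, IsSuccLimit α → F α ≤ ⨆ β < α, F β)
    (hcompl : ∀ α < o, IsComplemented (F α)) {T : Set Ordinal.{v}} {γ : Ordinal.{v}}
    (hγ : γ < o) (hT : ∀ δ ∈ T, δ < γ) : IsComplemented (partialSup F T) := by
  -- With μ the least strict upper bound of T, the sum is ⊥ if μ = 0 (F 0 itself may be nonzero) and
  -- F μ otherwise, by continuity when μ is a limit.
  obtain ⟨μ, hμ, hmin⟩ : ∃ μ : Ordinal.{v}, (∀ δ ∈ T, δ < μ) ∧ ∀ ν, (∀ δ ∈ T, δ < ν) → μ ≤ ν :=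
    ⟨sInf {ν | ∀ δ ∈ T, δ < ν}, csInf_mem (s := {ν | ∀ δ ∈ T, δ < ν}) ⟨γ, hT⟩,
      fun ν hν => csInf_le' hν⟩
  have hμo : μ < o := (hmin γ hT).trans_lt hγ
  rcases Ordinal.zero_or_succ_or_isSuccLimit μ with rfl | ⟨β, rfl⟩ | hlim
  · have : partialSup F T = ⊥ :=
      eq_bot_iff.2 (partialSup_le fun δ hδ => (not_lt_bot (hμ δ hδ)).elim)
    rw [this]
    exact isComplemented_bot
  · have hβ : β ∈ T := by
      by_contra hβ
      refine (hmin β fun δ hδ => ?_).not_gt (lt_succ β)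
      exact lt_of_le_of_ne (lt_succ_iff.1 (hμ δ hδ)) fun h => hβ (h ▸ hδ)
    have : partialSup F T = F (β + 1) := by
      refine le_antisymm (partialSup_le fun δ hδ => hmono _ _ ?_ hμo) (le_partialSup F hβ)
      exact add_one_le_of_lt (hμ δ hδ)
    rw [this]
    exact hcompl _ hμo
  · have : partialSup F T = F μ := by
      refine le_antisymm (partialSup_le fun δ hδ => hmono _ _ ?_ hμo)
        ((hcont μ hμo hlim).trans (iSup₂_le fun β hβ => ?_))
      · exact add_one_le_of_lt (hμ δ hδ)
      · have : ∃ δ ∈ T, β ≤ δ := by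
          by_contra! h
          exact (hmin β h).not_gt hβ
        obtain ⟨δ, hδ, hle⟩ := this
        exact (hmono β (δ + 1) (hle.trans le_self_add)
          (ho.add_one_lt ((hμ δ hδ).trans hμo))).trans (le_partialSup F hδ)
    rw [this]
    exact hcompl μ hμo

/-- The data for the gluing construction: a continuous filtration of a direct sum of at most `κ`
copies of `X`, consisting of complemented submodules but with a union that is not complemented,
and a tree-like ladder system on a non-reflecting stationary set, indexed by a small type. -/
structure IsLadderGluing (κ lam : Cardinal.{v}) {X : Type v} [AddCommGroup X] [Module R X]
    {K I : Type v} (F : Ordinal.{v} → Submodule R (K →₀ X)) (S : Set Ordinal.{v})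
    (c : Ordinal.{v} → Ordinal.{v} → Ordinal.{v}) (ht : I → Ordinal.{v}) : Prop where
  aleph0_le : ℵ₀ ≤ lam
  lt : lam < κ
  isLTGenerated : IsLTGenerated R κ X
  mk_le : #K ≤ κ
  mono : ∀ α β, α ≤ β → β < lam.ord → F α ≤ F β
  continuous : ∀ α < lam.ord, IsSuccLimit α → F α ≤ ⨆ β < α, F β
  isComplemented : ∀ α < lam.ord, IsComplemented (F α)
  not_isComplemented : ¬ IsComplemented (⨆ α < lam.ord, F α)
  subset : S ⊆ cofinalityClass (succ κ) lam
  stationary : StationaryIn S (succ κ).ord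
  nonReflecting : NonReflecting S (succ κ).ord
  isLadderSystem : IsLadderSystem lam S c
  isTreeLike : IsTreeLike lam S c
  injective : Function.Injective ht
  range_eq : Set.range ht = S

namespace IsLadderGluing

variable {κ lam : Cardinal.{v}} {X : Type v} [AddCommGroup X] [Module R X] {K I : Type v}
  {F : Ordinal.{v} → Submodule R (K →₀ X)} {S : Set Ordinal.{v}}
  {c : Ordinal.{v} → Ordinal.{v} → Ordinal.{v}} {ht : I → Ordinal.{v}}

theorem mem (H : IsLadderGluing κ lam F S c ht) (i : I) : ht i ∈ S :=
  H.range_eq ▸ Set.mem_range_self i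

theorem ht_lt (H : IsLadderGluing κ lam F S c ht) (i : I) : ht i < (succ κ).ord :=
  (H.subset (H.mem i)).1

theorem aleph0_le' (H : IsLadderGluing κ lam F S c ht) : ℵ₀ ≤ κ :=
  H.aleph0_le.trans H.lt.le

theorem cof_ord_succ (H : IsLadderGluing κ lam F S c ht) : (succ κ).ord.cof = succ κ :=
  (isRegular_succ H.aleph0_le').cof_ord

theorem isSuccLimit_ord (H : IsLadderGluing κ lam F S c ht) : IsSuccLimit lam.ord :=
  Cardinal.isSuccLimit_ord H.aleph0_le

theorem isSuccLimit_ord_succ (H : IsLadderGluing κ lam F S c ht) : IsSuccLimit (succ κ).ord :=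
  Cardinal.isSuccLimit_ord (H.aleph0_le'.trans (le_succ κ))

theorem tree (H : IsLadderGluing κ lam F S c ht) (i j : I) (δ : Ordinal.{v}) (hδ : δ < lam.ord)
    (h : c (ht i) δ = c (ht j) δ) : ∀ ξ < δ, c (ht i) ξ = c (ht j) ξ :=
  (H.isTreeLike _ (H.mem i) _ (H.mem j) δ hδ δ hδ h).2

theorem isComplemented_of_bounded (H : IsLadderGluing κ lam F S c ht) {T : Set Ordinal.{v}}
    {γ : Ordinal.{v}} (hγ : γ < lam.ord) (hT : ∀ δ ∈ T, δ < γ) :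
    IsComplemented (partialSup F T) :=
  isComplemented_partialSup H.isSuccLimit_ord H.mono H.continuous H.isComplemented hγ hT

theorem isComplemented_pair (H : IsLadderGluing κ lam F S c ht) (i j : I) (hij : j ≠ i) :
    IsComplemented (partialSup F (agreeSet lam.ord (fun i => c (ht i)) {i} j)) := by
  obtain ⟨γ, hγ, h⟩ :=
    H.isLadderSystem.exists_agree_lt (H.mem i) (H.mem j) (H.injective.ne hij.symm)
  refine H.isComplemented_of_bounded hγ ?_
  rintro δ ⟨hδ, k, rfl, hk⟩
  exact h δ hδ hk

theorem not_isComplemented_partialSup (H : IsLadderGluing κ lam F S c ht) :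
    ¬ IsComplemented (partialSup F (Set.Iio lam.ord)) := by
  convert H.not_isComplemented using 2
  refine le_antisymm (partialSup_le fun δ hδ => ?_) (iSup₂_le fun α hα => ?_)
  · exact le_iSup₂_of_le (f := fun α (_ : α < lam.ord) => F α) (δ + 1)
      (H.isSuccLimit_ord.add_one_lt hδ) le_rfl
  · exact (H.mono α (α + 1) le_self_add (H.isSuccLimit_ord.add_one_lt hα)).trans
      (le_partialSup F hα)

/-- The module constructed from the gluing data. -/
noncomputable abbrev glued (_ : IsLadderGluing κ lam F S c ht) : Type v :=
  Glued F lam.ord fun i => c (ht i)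

/-- The submodule generated by the pieces with height below `α`. -/
noncomputable def stage (H : IsLadderGluing κ lam F S c ht) (α : Ordinal.{v}) :
    Submodule R H.glued :=
  Glued.sub F lam.ord (fun i => c (ht i)) {i | ht i < α}

theorem of_mem_stage (H : IsLadderGluing κ lam F S c ht) {α : Ordinal.{v}} {i : I} (hi : ht i < α)
    (x : K →₀ X) : Glued.of F lam.ord (fun i => c (ht i)) i x ∈ H.stage α :=
  Glued.of_mem_sub (A := {i | ht i < α}) hi x

theorem stage_mono (H : IsLadderGluing κ lam F S c ht) : Monotone H.stage :=
  fun _ _ h => Glued.sub_mono fun _ hi => lt_of_lt_of_le hi h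

/-- Since α ∉ S, the remaining copies have index above α. Their ladders exceed α from some rung on
and from there agree with no ladder of index below α. -/
theorem isComplemented_stage (H : IsLadderGluing κ lam F S c ht) {α : Ordinal.{v}} (hα : α ∉ S) :
    IsComplemented (H.stage α) := by
  refine Glued.isComplemented_sub H.mono (fun δ => H.isSuccLimit_ord.add_one_lt) H.tree _
    fun i hi => ?_
  have hlt : α < ht i := lt_of_le_of_ne (not_lt.1 hi) fun h => hα (h ▸ H.mem i)
  obtain ⟨γ, hγ, hαγ⟩ := H.isLadderSystem.unbounded _ (H.mem i) α hlt
  refine H.isComplemented_of_bounded hγ ?_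
  rintro δ ⟨hδ, j, hj, heq⟩
  by_contra! hle
  have h1 := (H.isLadderSystem.strictMonoOn _ (H.mem i)).monotoneOn hγ hδ hle
  have h2 := H.isLadderSystem.lt _ (H.mem j) δ hδ
  simp only at heq
  rw [heq] at h1
  exact ((hαγ.trans_le h1).trans h2).not_gt hj

theorem addClass_stage (H : IsLadderGluing κ lam F S c ht) {α : Ordinal.{v}}
    (hα : α < (succ κ).ord) : AddClass R X (H.stage α) := by
  obtain ⟨ρ, hρ, hb⟩ := exists_rank H.aleph0_le H.subset H.nonReflecting H.isLadderSystem α hα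
  obtain ⟨f, g, hfg⟩ := Glued.exists_retract_sub H.mono
    (fun δ => H.isSuccLimit_ord.add_one_lt) H.tree H.isComplemented_pair {i | ht i < α}
    (fun i => ρ (ht i))
    (fun i hi j hj h => H.injective (hρ ⟨H.mem i, hi⟩ ⟨H.mem j, hj⟩ h)) (fun i hi => by
      obtain ⟨γ, hγ, h⟩ := hb _ (H.mem i) hi
      refine H.isComplemented_of_bounded hγ ?_
      rintro δ ⟨hδ, j, ⟨hj, hr⟩, heq⟩
      exact h _ (H.mem j) hj hr δ hδ heq)
  let e : (I × K →₀ X) ≃ₗ[R] (I →₀ K →₀ X) := Finsupp.curryLinearEquiv R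
  exact AddClass.of_retract (e.symm.toLinearMap ∘ₗ f) (g ∘ₗ e.toLinearMap) fun x =>
    (congrArg g (e.apply_symm_apply (f x))).trans (hfg x)

/-! ### Exhaustion by stages, freeness and separability. -/

theorem exists_mem_stage (H : IsLadderGluing κ lam F S c ht) (x : H.glued) :
    ∃ α < (succ κ).ord, x ∈ H.stage α := by
  have : ⨆ i, LinearMap.range (Glued.of F lam.ord (fun i => c (ht i)) i) = ⊤ :=
    Glued.iSup_range_of
  have hx : x ∈ ⨆ i, LinearMap.range (Glued.of F lam.ord (fun i => c (ht i)) i) :=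
    this ▸ Submodule.mem_top
  induction hx using Submodule.iSup_induction' with
  | mem i x hx =>
    obtain ⟨y, rfl⟩ := hx
    exact ⟨_, H.isSuccLimit_ord_succ.succ_lt (H.ht_lt i), H.of_mem_stage (lt_succ (ht i)) y⟩
  | zero => exact ⟨0, H.isSuccLimit_ord_succ.bot_lt, zero_mem _⟩
  | add x y _ _ hx hy =>
    obtain ⟨α, hα, hx⟩ := hx
    obtain ⟨β, hβ, hy⟩ := hy
    exact ⟨max α β, max_lt hα hβ,
      add_mem (H.stage_mono (le_max_left α β) hx) (H.stage_mono (le_max_right α β) hy)⟩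

theorem exists_subset_stage (H : IsLadderGluing κ lam F S c ht) (Y : Set H.glued)
    (hY : #Y < succ κ) : ∃ α < (succ κ).ord, Y ⊆ H.stage α := by
  choose α hα hmem using H.exists_mem_stage
  refine ⟨⨆ y : Y, α y, Ordinal.iSup_lt_of_lt_cof (by rwa [H.cof_ord_succ]) fun y => hα y,
    fun y hy => H.stage_mono (Ordinal.le_iSup (fun y : Y => α y) ⟨y, hy⟩) (hmem y)⟩

theorem isFreeRel (H : IsLadderGluing κ lam F S c ht) :
    IsFreeRel (succ κ) (AddClass R X) H.glued := by
  refine ⟨H.stage '' Set.Iio (succ κ).ord, ?_, ?_, ?_, ?_⟩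
  · rintro _ ⟨α, hα, rfl⟩ _ ⟨β, hβ, rfl⟩
    exact ⟨_, ⟨max α β, Set.mem_Iio.2 (max_lt hα hβ), rfl⟩, H.stage_mono (le_max_left α β),
      H.stage_mono (le_max_right α β)⟩
  · rintro _ ⟨α, hα, rfl⟩
    exact H.addClass_stage hα
  · intro o _ ho C _ hC
    choose α hα hαC using hC
    -- The union of the stages is the stage at the supremum of their heights, which stays below κ⁺
    -- by regularity.
    refine ⟨⨆ i, α i, Ordinal.lift_iSup_lt_of_lt_cof ?_ hα, le_antisymm ?_ ?_⟩
    · rw [← Ordinal.lift_cof, H.cof_ord_succ, Cardinal.mk_Iio_ordinal, Cardinal.lift_lift,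
        Cardinal.lift_lt]
      exact Cardinal.lt_ord.1 ho
    · refine Glued.sub_le fun i hi x => ?_
      obtain ⟨j, hj⟩ := Ordinal.lt_iSup_iff.1 hi
      refine le_iSup C j ?_
      rw [← hαC]
      exact H.of_mem_stage hj x
    · refine iSup_le fun i => ?_
      rw [← hαC]
      exact H.stage_mono (Ordinal.le_iSup α i)
  · intro Y hY
    obtain ⟨α, hα, h⟩ := H.exists_subset_stage Y hY
    exact ⟨_, ⟨α, hα, rfl⟩, h⟩

/-- Stages at successor ordinals suffice: they are summands because S consists of limit ordinals. -/
theorem isSeparableRel (H : IsLadderGluing κ lam F S c ht) :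
    IsSeparableRel (succ κ) (AddClass R X) H.glued := by
  intro Y hY
  obtain ⟨α, hα, h⟩ := H.exists_subset_stage Y hY
  refine ⟨H.stage (succ α), H.isComplemented_stage fun hS => ?_,
    H.addClass_stage (H.isSuccLimit_ord_succ.succ_lt hα),
    h.trans (H.stage_mono (le_succ α))⟩
  exact (isSuccLimit_of_mem_cofinalityClass H.aleph0_le (H.subset hS)).succ_ne α rfl

/-! ### Non-membership in Add(X) and the number of generators. -/

theorem exists_generators (H : IsLadderGluing κ lam F S c ht) :
    ∃ G : Set (K →₀ X), #G ≤ κ ∧ Submodule.span R G = ⊤ := by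
  obtain ⟨G, hGκ, hG⟩ := H.isLTGenerated
  refine ⟨Set.range fun a : K × G => Finsupp.single a.1 (a.2 : X), ?_, ?_⟩
  · refine mk_range_le.trans ?_
    rw [mk_prod, Cardinal.lift_id, Cardinal.lift_id]
    exact mul_le_of_le H.aleph0_le' H.mk_le hGκ.le
  · rw [eq_top_iff, ← Finsupp.iSup_lsingle_range]
    refine iSup_le fun k => ?_
    rw [LinearMap.range_eq_map, ← hG, Submodule.map_span]
    refine Submodule.span_mono ?_
    rintro _ ⟨x, hx, rfl⟩
    exact ⟨(k, ⟨x, hx⟩), rfl⟩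

/-- At a closure point η the retract maps respect the filtration: f sends M_η into the coordinates
`J η`, and g sends these back into M_η. Through `h₀` a further closure condition can be imposed on
η. -/
theorem exists_isComplemented_stage (H : IsLadderGluing κ lam F S c ht)
    (hAdd : AddClass R X H.glued) (h₀ : Ordinal.{v} → Ordinal.{v})
    (hh₀ : ∀ β < (succ κ).ord, h₀ β < (succ κ).ord) :
    ∃ η ∈ S, (∀ β < η, h₀ β ≤ η) ∧ IsComplemented (H.stage η) := by
  classical
  obtain ⟨ι, f, g, hfg⟩ := hAdd.exists_retract
  obtain ⟨G, hGκ, hG⟩ := H.isLTGenerated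
  obtain ⟨B, hBκ, hB⟩ := H.exists_generators
  let J : Ordinal.{v} → Set ι := fun α => {j | ∀ x, g (Finsupp.single j x) ∈ H.stage α}
  have hJmono : Monotone J := fun α β hαβ j hj x => H.stage_mono hαβ (hj x)
  -- A copy has at most κ generators, each with image of finite support under f, so the coordinates
  -- involved are all sent by g into one stage below κ⁺.
  have hsmall : ∀ i : I, ∃ α < (succ κ).ord, ∀ l,
      f (Glued.of F lam.ord (fun i => c (ht i)) i l) ∈ Finsupp.supported X R (J α) := by
    intro i
    let s : B → Finset ι := fun b => (f (Glued.of F lam.ord (fun i => c (ht i)) i b)).support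
    obtain ⟨α, hα, hsub⟩ := H.exists_subset_stage
      (⋃ a : B × G, (fun j => g (Finsupp.single j (a.2 : X))) '' (s a.1 : Set ι)) (by
        rw [lt_succ_iff]
        refine (mk_iUnion_le _).trans (mul_le_of_le H.aleph0_le' ?_ ?_)
        · rw [mk_prod, Cardinal.lift_id, Cardinal.lift_id]
          exact mul_le_of_le H.aleph0_le' hBκ hGκ.le
        · exact ciSup_le' fun a => (Cardinal.mk_le_aleph0_iff.2
            ((Finset.countable_toSet _).image _).to_subtype).trans H.aleph0_le')
    refine ⟨α, hα, fun l => ?_⟩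
    have hle : Submodule.span R B ≤ (Finsupp.supported X R (J α)).comap
        (f ∘ₗ Glued.of F lam.ord (fun i => c (ht i)) i) := by
      refine Submodule.span_le.2 fun b hb j hj x => ?_
      have hle' : Submodule.span R G ≤ (H.stage α).comap (g ∘ₗ Finsupp.lsingle j) :=
        Submodule.span_le.2 fun y hy =>
          hsub (Set.mem_iUnion.2 ⟨(⟨b, hb⟩, ⟨y, hy⟩), ⟨j, hj, rfl⟩⟩)
      rw [hG] at hle'
      exact hle' (Submodule.mem_top (x := x))
    rw [hB] at hle
    exact hle (Submodule.mem_top (x := l))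
  choose h₁ hh₁ hsupp using hsmall
  obtain ⟨η, hη, -, hclosed⟩ := exists_mem_closed_of_stationaryIn H.aleph0_le' H.stationary
    (fun β => max (h₀ β) (if h : ∃ i, ht i = β then h₁ h.choose else 0)) (fun β hβ => by
      refine max_lt (hh₀ β hβ) ?_
      split_ifs
      · exact hh₁ _
      · exact H.isSuccLimit_ord_succ.bot_lt)
  refine ⟨η, hη, fun β hβ => (le_max_left _ _).trans (hclosed β hβ), ?_⟩
  have hf : H.stage η ≤ (Finsupp.supported X R (J η)).comap f := by
    refine Glued.sub_le fun i hi l => Finsupp.supported_mono (hJmono ?_) (hsupp i l)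
    have hex : ∃ j, ht j = ht i := ⟨i, rfl⟩
    have h2 := (le_max_right _ _).trans (hclosed (ht i) hi)
    rwa [dif_pos hex, H.injective hex.choose_spec] at h2
  have hg : Finsupp.supported X R (J η) ≤ (H.stage η).comap g := by
    intro x hx
    rw [Submodule.mem_comap, ← Finsupp.sum_single x, Finsupp.sum, map_sum]
    exact Submodule.sum_mem _ fun j hj => hx hj _
  obtain ⟨q, hq, hq'⟩ := Submodule.exists_retraction
    (P := Finsupp.supported X R (J η)) ⟨_, Finsupp.disjoint_supported_supported disjoint_compl_right,
      Finsupp.codisjoint_supported_supported isCompl_compl.codisjoint⟩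
  refine Submodule.isComplemented_of_retraction (g ∘ₗ q ∘ₗ f) (fun x => hg (hq _)) fun x hx => ?_
  simp [hq' _ (hf hx), hfg]

theorem not_addClass (H : IsLadderGluing κ lam F S c ht) : ¬ AddClass R X H.glued := by
  classical
  intro hAdd
  let on : Ordinal.{v} → I → Prop := fun β i => ∃ δ < lam.ord, c (ht i) δ = β
  -- The ladder chosen through β depends on β alone, so closure of η puts every rung of c η on a
  -- ladder of index below η. By tree-likeness it is the same rung there, so F (δ + 1) in copy η
  -- lies in the stage η.
  obtain ⟨η, hη, hclosed, hcompl⟩ := H.exists_isComplemented_stage hAdd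
    (fun β => if h : ∃ i, on β i then succ (ht h.choose) else 0) (fun β _ => by
      split_ifs
      · exact H.isSuccLimit_ord_succ.succ_lt (H.ht_lt _)
      · exact H.isSuccLimit_ord_succ.bot_lt)
  rw [← H.range_eq] at hη
  obtain ⟨i, rfl⟩ := hη
  obtain ⟨p, hp, hp'⟩ := Submodule.exists_retraction hcompl
  obtain ⟨r, hr, hr'⟩ := Glued.exists_toPiece H.mono
    (fun δ => H.isSuccLimit_ord.add_one_lt) H.tree i fun j hj => H.isComplemented_pair i j hj
  have hrN : H.stage (ht i) ≤ (partialSup F (Set.Iio lam.ord)).comap r := by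
    refine Glued.sub_le fun j hj x => ?_
    refine partialSup_mono F (fun δ hδ => hδ.1) (hr' j ?_ x)
    rintro rfl
    exact lt_irrefl (ht j) hj
  have hN : partialSup F (Set.Iio lam.ord) ≤
      (H.stage (ht i)).comap (Glued.of F lam.ord (fun i => c (ht i)) i) := by
    refine partialSup_le fun δ hδ x hx => ?_
    have hex : ∃ j, on (c (ht i) δ) j := ⟨i, δ, hδ, rfl⟩
    have h1 := hclosed _ (H.isLadderSystem.lt _ (H.mem i) δ hδ)
    rw [dif_pos hex] at h1
    obtain ⟨δ', hδ', heq⟩ := hex.choose_spec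
    obtain ⟨rfl, -⟩ := H.isTreeLike _ (H.mem _) _ (H.mem i) δ' hδ' δ hδ heq
    rw [Submodule.mem_comap, Glued.of_eq (j := hex.choose) hδ heq.symm hx]
    exact H.of_mem_stage (lt_of_lt_of_le (lt_succ _) h1) x
  refine H.not_isComplemented_partialSup (Submodule.isComplemented_of_retraction
    (r ∘ₗ p ∘ₗ Glued.of F lam.ord (fun i => c (ht i)) i) (fun x => hrN (hp _)) fun x hx => ?_)
  rw [LinearMap.comp_apply, LinearMap.comp_apply, hp' _ (hN hx), hr]

/-- Generators of the copies number at most κ⁺, and padding with κ⁺ elements makes the count exact.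
That many elements exist, since a smaller M would be a single stage and so belong to Add(X). -/
theorem isGeneratedBy (H : IsLadderGluing κ lam F S c ht) :
    IsGeneratedBy R (succ κ) H.glued := by
  have hM : succ κ ≤ #H.glued := by
    by_contra! hlt
    obtain ⟨α, hα, h⟩ := H.exists_subset_stage Set.univ (by rwa [mk_univ])
    obtain ⟨ι, f, g, hfg⟩ := (H.addClass_stage hα).exists_retract
    have hmem : ∀ x, x ∈ H.stage α := fun x => h (Set.mem_univ x)
    exact H.not_addClass (AddClass.of_retract (f ∘ₗ LinearMap.id.codRestrict _ hmem)
      ((H.stage α).subtype ∘ₗ g) fun x => by simp [hfg])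
  obtain ⟨Y, hY⟩ := le_mk_iff_exists_set.1 hM
  obtain ⟨B, hBκ, hB⟩ := H.exists_generators
  have hI : #I ≤ succ κ := by
    have h2 : Cardinal.lift.{v + 1} #I ≤ Cardinal.lift.{v} #(Set.Iio (succ κ).ord) :=
      Cardinal.lift_mk_le_lift_mk_of_injective
        (f := fun i : I => (⟨ht i, H.ht_lt i⟩ : Set.Iio (succ κ).ord))
        fun i j h => H.injective (congrArg Subtype.val h)
    rwa [Cardinal.mk_Iio_ordinal, Cardinal.lift_lift, Cardinal.lift_le, card_ord] at h2
  have hκ := H.aleph0_le'.trans (le_succ κ)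
  refine ⟨Y ∪ Set.range fun a : I × B => Glued.of F lam.ord (fun i => c (ht i)) a.1 a.2,
    le_antisymm ((mk_union_le _ _).trans (add_le_of_le hκ hY.le ?_)) ?_, ?_⟩
  · refine mk_range_le.trans ?_
    rw [mk_prod, Cardinal.lift_id, Cardinal.lift_id]
    exact mul_le_of_le hκ hI (hBκ.trans (le_succ κ))
  · exact hY.ge.trans (mk_le_mk_of_subset Set.subset_union_left)
  · rw [eq_top_iff, ← Glued.iSup_range_of]
    refine iSup_le fun i => ?_
    rw [LinearMap.range_eq_map, ← hB, Submodule.map_span]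
    refine Submodule.span_mono (Set.subset_union_of_subset_right ?_ _)
    rintro _ ⟨x, hx, rfl⟩
    exact ⟨(i, ⟨x, hx⟩), rfl⟩

end IsLadderGluing

end LadderGluing

theorem theorem3 {R : Type u} [Ring R] (κ lam : Cardinal.{v}) (hlam : lam.IsRegular)
    (hlt : lam < κ) (hstar : StarPrinciple κ lam)
    (X : Type v) [AddCommGroup X] [Module R X] (hX : IsLTGenerated R κ X)
    (L : Type v) [AddCommGroup L] [Module R L] (N : Submodule R L)
    (F : Ordinal.{v} → Submodule R L) (hT : IsTemplate lam (AddClass R X) L N F) :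
    ∃ (M : Type v) (_ : AddCommGroup M) (_ : Module R M),
      IsGeneratedBy R (succ κ) M ∧
      IsFreeRel (succ κ) (AddClass R X) M ∧
      IsSeparableRel (succ κ) (AddClass R X) M ∧
      ¬ AddClass R X M := by
  obtain ⟨S, hS, hst, hnr, c, hc, htree⟩ := hstar
  obtain ⟨K, F', hK, hmono, hcont, hcompl, hnot⟩ := hT.exists_small hlam.aleph0_le hlt hX
  -- Ordinals live one universe above the modules; S is bounded, so it can be reindexed by a type in
  -- universe v.
  have : Small.{v} S := small_subset (show S ⊆ Set.Iio (succ κ).ord from fun α hα => (hS hα).1)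
  have H : IsLadderGluing κ lam F' S c fun i : Shrink.{v} S => ((equivShrink S).symm i : Ordinal) :=
    { aleph0_le := hlam.aleph0_le
      lt := hlt
      isLTGenerated := hX
      mk_le := hK
      mono := hmono
      continuous := hcont
      isComplemented := hcompl
      not_isComplemented := hnot
      subset := hS
      stationary := hst
      nonReflecting := hnr
      isLadderSystem := hc
      isTreeLike := htree
      injective := Subtype.val_injective.comp (equivShrink S).symm.injective
      range_eq := by
        rw [← Function.comp_def, (equivShrink S).symm.surjective.range_comp, Subtype.range_coe] }
  exact ⟨H.glued, inferInstance, inferInstance, H.isGeneratedBy, H.isFreeRel, H.isSeparableRel,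
    H.not_addClass⟩
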